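/- **Vehicles.** There are controlled vehicles $j\in\mathcal C=\{1,\dots,n_c\}$ and uncontrolled vehicles $\gamma\in\bar{\mathcal C}=\{n_c+1,\dots,n\}$. The state $x_i=(y_i,v_i)\in X_i=Y_i\times[v_{i,\min},v_{i,\max}]$ (position, speed) of vehicle $i$ solves $\dot x_j=F_j(x_j,u_j,d_j)$ for $j\in\mathcal C$ and $\dot x_\gamma=F_\gamma(x_\gamma,w_\gamma,d_\gamma)$ for $\gamma\in\bar{\mathcal C}$ (in integral form), with signals $u_j(\cdot)\in\mathcal U_j$, $w_\gamma(\cdot)\in\mathcal W_\gamma$, $d_i(\cdot)\in\mathcal D_i$ on $t\ge 0$ whose values lie in given compact intervals (boxes for $d_i$). For all admissible data there is exactly one solution in $X_i$ on $[0,\infty)$. Open intervals $(\alpha_i,\beta_i)$, $\alpha_i<\beta_i$, are the locations of the intersection on the paths, and $[x_i^a(0),x_i^b(0)]\subseteq X_i$ are given boxes of initial states, $x_i^a(0)\le x_i^b(0)$. All orders are componentwise and, for signals, pointwise in time. **Standing assumptions.** (1) $x_i(t)$ is nondecreasing in the input signal, in the disturbance signal and in the initial state. (2) $y_i(t)$ is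 nondecreasing in $t$. (3) For $j\in\mathcal C$, $\mathcal U_j$ is path-connected and $x_j(t)$ depends continuously on $u_j(\cdot)\in\mathcal U_j$. (4) $\mathcal D_i$ and $\mathcal W_\gamma$ each have a least and a greatest signal. Let $x^a_j(t,u_j),x^b_j(t,u_j)$ be the minimum and maximum of $x_j(t)$ over $d_j\in\mathcal D_j$, $x_j(0)\in[x^a_j(0),x^b_j(0)]$, and $x_\gamma^a(t),x_\gamma^b(t)$ those of $x_\gamma(t)$ over $w_\gamma,d_\gamma,x_\gamma(0)$; let $y^a,y^b$ be their position components. (5) At each time the set of positions over which the minimum and maximum are taken is an interval. (6) For $j\in\mathcal C$, $y_j^a(t,u_j)-y_j^a(s,u_j)\le v_{j,\max}(t-s)$ for $0\le s\le t$. **Scheduling parameters.** Let $\mathcal M=\{j\in\mathcal C:y_j^b(0)<\alpha_j\}$, $\bar{\mathcal M}=\mathcal C\setminus\mathcal M$. For $j\in\mathcal M$, $R_j$ and $D_j$ are the infimum and supremum of $\{t\ge0: y_j^b(t,u_j)=\alpha_j,\ u_j\in\mathcal U_j\}$; for $j\in\bar{\mathcal M}$, $R_j=D_j=0$. The process time $P_j(T)$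 is $0$ if $y_j^a(0)\ge\beta_j$; otherwise, for $j\in\bar{\mathcal M}$ it is $\inf\{t\ge 0:y_j^a(t,u_j)=\beta_j,\ u_j\in\mathcal U_j\}$, and for $j\in\mathcal M$ it is $\inf\{t-T\ge0:y^a_j(t,u_j)=\beta_j,\ y^b_j(T,u_j)=\alpha_j,\ u_j\in\mathcal U_j\}$ ($\infty$ if there is no such $t$). For $\gamma\in\bar{\mathcal C}$, $\bar R_\gamma$ is the first time with $y^b_\gamma=\alpha_\gamma$ if $y^b_\gamma(0)<\alpha_\gamma$, and $0$ otherwise; $\bar P_\gamma$ is the first time with $y^a_\gamma=\beta_\gamma$ if $y^a_\gamma(0)<\beta_\gamma$, and $0$ otherwise. Let $\theta_{\max}=\sup_{j\in\mathcal C}\sup_{R_j\le T\le D_j}P_j(T)$ and $P_{\max}=\max_{j\in\bar{\mathcal M}}P_j(0)$ ($0$ if $\bar{\mathcal M}=\emptyset$). Assume that $R_j,D_j,\bar R_\gamma,\bar P_\gamma,\theta_{\max}$ are finite, and that $y_j^b(\cdot,u_j)$ (for each $u_j\in\mathcal U_j$) and $y_\gamma^b$ take the values $\alpha_j$ and $\alpha_\gamma$,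 respectively, at most once on $t\ge0$. **Bad sets.** $B$ is the set of $\mathbf y\in\prod_iY_i$ such that $y_i\in(\alpha_i,\beta_i)$ and $y_j\in(\alpha_j,\beta_j)$ for some $i\ne j$ with $i\in\mathcal C\cup\bar{\mathcal C}$, $j\in\mathcal C$. Put $\hat\beta_j=\alpha_j+\theta_{\max}v_{j,\max}$ for $j\in\mathcal C$ and $\hat\beta_\gamma=\beta_\gamma$ for $\gamma\in\bar{\mathcal C}$; the inflated Bad set $\hat B$ is defined like $B$ with $\hat\beta_i$ in place of $\beta_i$. Assume $\beta_j\le\hat\beta_j$ for every $j\in\mathcal C$ with $\alpha_j<y_j^a(0)<\beta_j$. **Procedure Approx.** If $[\mathbf y^a(0),\mathbf y^b(0)]\cap B\neq\emptyset$, answer *no*. Otherwise, if $\mathcal M=\emptyset$, answer *yes*. Otherwise let $\pi^*$ be the sequence returned by Polynomial for the jobs $j\in\mathcal M$ with $r_j=\max(R_j,P_{\max})/\theta_{\max}$, $d_j=D_j/\theta_{\max}$ and initial forbidden regions $F_\gamma=(\max(\bar R_\gamma/\theta_{\max}-1,0),\bar P_\gamma/\theta_{\max})$, $\gamma\in\bar{\mathcal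 C}$, and answer as Scheduling does for $\pi^*$. Ties are broken by the numbering of the vehicles (in a minimization or a sort). *Polynomial* (unit-time jobs with release times $r_j$ and start deadlines $d_j$). Forbidden region declaration: go through the jobs $i$ from the last to the first in increasing order of release time. For each job $j$ with $d_j\ge d_i$, set $c_j:=d_j$ if $c_j$ is undefined and $c_j:=c_j-1$ otherwise, and then, while $c_j$ lies in a forbidden region, replace $c_j$ by the left end of that region. If $i$ is the first job in the order, or its predecessor has a release time $<r_i$, set $c:=\min\{c_j: c_j\text{ defined}\}$. When $c$ is defined: if $c<r_i$, Polynomial's own answer becomes *no*; if $r_i\le c<r_i+1$, add the forbidden region $(c-1,r_i)$. Schedule generation: start with $s=0$. While jobs remain, increase $s$ to the least release time of the remaining jobs if $s$ is smaller, then, while $s$ lies in a forbidden region, replace $s$ by the right end of that region; among the remaining jobs with $r_j\le s$ pick one with the least $d_j$, set $t_j:=s$, remove it, and set $s:=s+1$. The returned sequence lists the jobs by increasing $t_j$ (whatever Polynomial's own answer is). *Scheduling*. Set $T_j=0$ for $j\in\bar{\mathcal M}$. For $i=1,2,\dots$, set $T_{\pi_1}:=\max(R_{\pi_1},P_{\max})$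 or, for $i\ge2$, $T_{\pi_i}:=\max(R_{\pi_i},T_{\pi_{i-1}}+P_{\pi_{i-1}}(T_{\pi_{i-1}}))$; then, for the uncontrolled vehicles $\gamma$ in increasing order of $\bar R_\gamma$: if $T_{\pi_i}\ge\bar R_\gamma$, set $T_{\pi_i}:=\max(T_{\pi_i},\bar P_\gamma)$; otherwise, if $T_{\pi_i}+P_{\pi_i}(T_{\pi_i})>\bar R_\gamma$, set $T_{\pi_i}:=\bar P_\gamma$. Answer *yes* if $T_j\le D_j$ for all $j\in\mathcal C$, and *no* otherwise. **Theorem.** If procedure Approx answers *no*, then there is no input signal $\mathbf u(\cdot)\in\prod_{j\in\mathcal C}\mathcal U_j$ such that $\mathbf y(t)\notin\hat B$ for all $t\ge0$, all driver-inputs $w_\gamma(\cdot)\in\mathcal W_\gamma$, all disturbances $d_i(\cdot)\in\mathcal D_i$ and all initial states $\mathbf x(0)\in[\mathbf x^a(0),\mathbf x^b(0)]$. -/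

import Mathlib

open scoped ENNReal

noncomputable section

namespace Intersection

/-! ## Vehicles -/

/-- A vehicle. `F` is the vector field as a function of the state (position, speed), the input
and the disturbance (on position, on speed); `Y` is the position space; `inputs` and `dists` are
the spaces of input signals and of disturbance signals, as functions of the time `t ≥ 0` (values
at negative times are never used); the open interval `(α, β)` is the conflict area on the path
of the vehicle. -/
structure Vehicle where
  F : ℝ × ℝ → ℝ → ℝ × ℝ → ℝ × ℝ
  Y : Set ℝ
  vmin : ℝ
  vmax : ℝ
  inMin : ℝ
  inMax : ℝ
  inputs : Set (ℝ → ℝ)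
  dMin : ℝ × ℝ
  dMax : ℝ × ℝ
  dists : Set (ℝ → ℝ × ℝ)
  α : ℝ
  β : ℝ

/-- The pointwise order of signals on `t ≥ 0`. -/
def SigLE {E : Type*} [LE E] (f g : ℝ → E) : Prop := ∀ t, 0 ≤ t → f t ≤ g t

namespace Vehicle

variable (V : Vehicle)

/-- The state space: position in `Y`, speed in `[vmin, vmax]`. -/
def X : Set (ℝ × ℝ) := V.Y ×ˢ Set.Icc V.vmin V.vmax

/-- `x` solves `x' = F (x, u, d)`, `x 0 = x0` on `t ≥ 0` (in integral form, so that measurable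
signals and discontinuous vector fields are allowed) and stays in the state space. -/
def IsTrajectory (u : ℝ → ℝ) (d : ℝ → ℝ × ℝ) (x0 : ℝ × ℝ) (x : ℝ → ℝ × ℝ) : Prop :=
  ∀ t, 0 ≤ t → x t ∈ V.X ∧
    IntervalIntegrable (fun s => V.F (x s) (u s) (d s)) MeasureTheory.volume 0 t ∧
    x t = x0 + ∫ s in (0 : ℝ)..t, V.F (x s) (u s) (d s)

open Classical in
/-- The state `x (t, u, d, x0)` at time `t`. -/
def traj (u : ℝ → ℝ) (d : ℝ → ℝ × ℝ) (x0 : ℝ × ℝ) : ℝ → ℝ × ℝ :=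
  if h : ∃ x, V.IsTrajectory u d x0 x then h.choose else fun _ => x0

/-- Admissible signals take their values in the given bounds, the conflict area is a nonempty
interval, and the differential equation has exactly one solution on `t ≥ 0` for all admissible
data. -/
structure WellPosed : Prop where
  lt : V.α < V.β
  inputs_bdd : ∀ u ∈ V.inputs, ∀ t, 0 ≤ t → u t ∈ Set.Icc V.inMin V.inMax
  dists_bdd : ∀ d ∈ V.dists, ∀ t, 0 ≤ t → d t ∈ Set.Icc V.dMin V.dMax
  exists_traj : ∀ u ∈ V.inputs, ∀ d ∈ V.dists, ∀ x0 ∈ V.X, ∃ x, V.IsTrajectory u d x0 x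
  unique_traj : ∀ u ∈ V.inputs, ∀ d ∈ V.dists, ∀ x0 ∈ V.X, ∀ x x',
    V.IsTrajectory u d x0 x → V.IsTrajectory u d x0 x' → ∀ t, 0 ≤ t → x t = x' t

/-- The dynamics preserve the order in the input, in the disturbance and in the initial state
(positions and speeds are compared componentwise). -/
structure OrderPreserving : Prop where
  input : ∀ u ∈ V.inputs, ∀ u' ∈ V.inputs, ∀ d ∈ V.dists, ∀ x0 ∈ V.X,
    SigLE u u' → SigLE (V.traj u d x0) (V.traj u' d x0)
  dist : ∀ u ∈ V.inputs, ∀ d ∈ V.dists, ∀ d' ∈ V.dists, ∀ x0 ∈ V.X,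
    SigLE d d' → SigLE (V.traj u d x0) (V.traj u d' x0)
  init : ∀ u ∈ V.inputs, ∀ d ∈ V.dists, ∀ x0 ∈ V.X, ∀ x0' ∈ V.X,
    x0 ≤ x0' → SigLE (V.traj u d x0) (V.traj u d x0')

/-- The position is nondecreasing in time. -/
def PositionMonotone : Prop :=
  ∀ u ∈ V.inputs, ∀ d ∈ V.dists, ∀ x0 ∈ V.X,
    MonotoneOn (fun t => (V.traj u d x0 t).1) (Set.Ici 0)

/-- The input signal space is path-connected and the state depends continuously on the input
signal, for some topology on the input signal space. -/
def ContinuousInInput : Prop :=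
  ∃ _ : TopologicalSpace V.inputs, PathConnectedSpace V.inputs ∧
    ∀ d ∈ V.dists, ∀ x0 ∈ V.X, ∀ t, 0 ≤ t → Continuous fun u : V.inputs => V.traj u d x0 t

/-- `A` has a least and a greatest signal. -/
def HasExtremes {E : Type*} [LE E] (A : Set (ℝ → E)) : Prop :=
  (∃ f ∈ A, ∀ g ∈ A, SigLE f g) ∧ (∃ f ∈ A, ∀ g ∈ A, SigLE g f)

/-- The states at time `t` for inputs in `U`, any disturbance and any initial state in
`[a, b]`. -/
def reach (U : Set (ℝ → ℝ)) (a b : ℝ × ℝ) (t : ℝ) : Set (ℝ × ℝ) :=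
  {x | ∃ u ∈ U, ∃ d ∈ V.dists, ∃ x0 ∈ Set.Icc a b, x = V.traj u d x0 t}

/-- The lower state estimate. Infimum and supremum in `ℝ × ℝ` are componentwise; they are the
minimum and the maximum when these exist. -/
def lowerState (U : Set (ℝ → ℝ)) (a b : ℝ × ℝ) (t : ℝ) : ℝ × ℝ := sInf (V.reach U a b t)

/-- The upper state estimate, see `lowerState`. -/
def upperState (U : Set (ℝ → ℝ)) (a b : ℝ × ℝ) (t : ℝ) : ℝ × ℝ := sSup (V.reach U a b t)

/-- The positions that are possible at any given time form an interval. -/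
def PositionsInterval (U : Set (ℝ → ℝ)) (a b : ℝ × ℝ) : Prop :=
  ∀ t, 0 ≤ t → (Prod.fst '' V.reach U a b t).OrdConnected

end Vehicle

/-! ## Scheduling jobs of unit length -/

section Polynomial

variable {ι : Type*} [DecidableEq ι]

/-- Moves `c` down out of the open intervals in `F`: while `c` lies in one of them, it is
replaced by its left end (`F.length` rounds suffice, as no interval is met twice). -/
def leaveDown (F : List (ℝ × ℝ)) (c : ℝ) : ℝ :=
  (fun c => match F.find? (fun I => I.1 < c ∧ c < I.2) with
    | some I => I.1
    | none => c)^[F.length] c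

/-- Moves `s` up out of the open intervals in `F`: while `s` lies in one of them, it is
replaced by its right end. -/
def leaveUp (F : List (ℝ × ℝ)) (s : ℝ) : ℝ :=
  (fun s => match F.find? (fun I => I.1 < s ∧ s < I.2) with
    | some I => I.2
    | none => s)^[F.length] s

/-- The variables of the forbidden region declaration: the numbers `c_j`, the critical time
`c` (`none` means undefined), the forbidden regions, and the answer. -/
structure DeclState (ι : Type*) where
  cs : ι → Option ℝ
  c : Option ℝ
  F : List (ℝ × ℝ)
  ans : Bool

/-- The pass of the declaration loop for job `i`; `p` is the previous job in the order of
release times, if any. -/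
def declStep (jobs : List ι) (r d : ι → ℝ) (p : Option ι) (i : ι) (st : DeclState ι) :
    DeclState ι :=
  let cs : ι → Option ℝ := fun j =>
    if d i ≤ d j then
      some (leaveDown st.F (match st.cs j with
        | none => d j
        | some c => c - 1))
    else st.cs j
  let c : Option ℝ := if (∀ q ∈ p, r q < r i) then (jobs.filterMap cs).min? else st.c
  match c with
  | none => ⟨cs, none, st.F, st.ans⟩
  | some x =>
    ⟨cs, some x, if r i ≤ x ∧ x < r i + 1 then (x - 1, r i) :: st.F else st.F,
      if x < r i then false else st.ans⟩

/-- The declaration loop, from the last job of the list to the first. -/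
def declLoop (jobs : List ι) (r d : ι → ℝ) (F₀ : List (ℝ × ℝ)) :
    Option ι → List ι → DeclState ι
  | _, [] => ⟨fun _ => none, none, F₀, true⟩
  | p, i :: l => declStep jobs r d p i (declLoop jobs r d F₀ (some i) l)

/-- Schedule generation. At each of `n` rounds, time `s` moves to the first time, not before
any remaining job is released, that lies outside of the forbidden regions; of the remaining jobs
that are released by then (`A`) one with the earliest deadline starts. -/
def generate (F : List (ℝ × ℝ)) (r d : ι → ℝ) : ℕ → ℝ → List ι → (ι → ℝ) → (ι → ℝ)
  | 0, _, _, t => t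
  | n + 1, s, B, t =>
    match B.argmin r with
    | none => t
    | some k =>
      let s' := leaveUp F (max s (r k))
      let A := B.filter fun l => r l ≤ s'
      match A.argmin d with
      | none => t
      | some j => generate F r d n (s' + 1) (B.erase j) (Function.update t j s')

/-- Procedure Polynomial: the schedule of the jobs in `jobs` with release times `r`, deadlines
`d` (for the start of a job) and initial forbidden regions `F₀` (`none` if the answer is no), the
jobs in the order of their start times, and the answer. -/
def polynomial (jobs : List ι) (r d : ι → ℝ) (F₀ : List (ℝ × ℝ)) :
    Option (ι → ℝ) × List ι × Bool :=
  let σ := jobs.insertionSort fun i j => r i ≤ r j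
  let st := declLoop jobs r d F₀ none σ
  let t := generate st.F r d jobs.length 0 jobs fun _ => 0
  let π := jobs.insertionSort fun i j => t i ≤ t j
  if st.ans then (some t, π, true) else (none, π, false)

end Polynomial

/-! ## The intersection -/

/-- An instance of the verification problem: `nc` controlled vehicles (`Sum.inl j`), `nu`
uncontrolled vehicles (`Sum.inr γ`), and the initial state estimation `[xa, xb]`. -/
structure Instance (nc nu : ℕ) where
  veh : Fin nc ⊕ Fin nu → Vehicle
  xa : Fin nc ⊕ Fin nu → ℝ × ℝ
  xb : Fin nc ⊕ Fin nu → ℝ × ℝ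

namespace Instance

variable {nc nu : ℕ} (S : Instance nc nu)

/-- The `j`-th controlled vehicle. -/
def ctrl (j : Fin nc) : Vehicle := S.veh (Sum.inl j)

/-- The `γ`-th uncontrolled vehicle. -/
def unctrl (γ : Fin nu) : Vehicle := S.veh (Sum.inr γ)

/-- `y_j^a (t, u)`: the lower position estimate of controlled vehicle `j`. -/
def ya (j : Fin nc) (u : ℝ → ℝ) (t : ℝ) : ℝ :=
  ((S.ctrl j).lowerState {u} (S.xa (Sum.inl j)) (S.xb (Sum.inl j)) t).1

/-- `y_j^b (t, u)`: the upper position estimate of controlled vehicle `j`. -/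
def yb (j : Fin nc) (u : ℝ → ℝ) (t : ℝ) : ℝ :=
  ((S.ctrl j).upperState {u} (S.xa (Sum.inl j)) (S.xb (Sum.inl j)) t).1

/-- `y_γ^a (t)`: the lower position estimate of uncontrolled vehicle `γ`. -/
def yaUn (γ : Fin nu) (t : ℝ) : ℝ :=
  ((S.unctrl γ).lowerState (S.unctrl γ).inputs (S.xa (Sum.inr γ)) (S.xb (Sum.inr γ)) t).1

/-- `y_γ^b (t)`: the upper position estimate of uncontrolled vehicle `γ`. -/
def ybUn (γ : Fin nu) (t : ℝ) : ℝ :=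
  ((S.unctrl γ).upperState (S.unctrl γ).inputs (S.xa (Sum.inr γ)) (S.xb (Sum.inr γ)) t).1

/-- `y_i^a (0)`. -/
def ya0 (i : Fin nc ⊕ Fin nu) : ℝ := (S.xa i).1

/-- `y_i^b (0)`. -/
def yb0 (i : Fin nc ⊕ Fin nu) : ℝ := (S.xb i).1

/-! ### Scheduling parameters -/

/-- Controlled vehicle `j` is before its intersection at time `0`, that is, `j ∈ ℳ`. -/
def Before (j : Fin nc) : Prop := S.yb0 (Sum.inl j) < (S.ctrl j).α

/-- The times at which `y_j^b` can be at `α_j`. -/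
def entryTimes (j : Fin nc) : Set ℝ≥0∞ :=
  {T | ∃ u ∈ (S.ctrl j).inputs, ∃ t : ℝ, 0 ≤ t ∧ S.yb j u t = (S.ctrl j).α ∧ T = ENNReal.ofReal t}

open Classical in
/-- The release time `R_j`. -/
def R (j : Fin nc) : ℝ≥0∞ := if S.Before j then sInf (S.entryTimes j) else 0

open Classical in
/-- The deadline `D_j`. -/
def D (j : Fin nc) : ℝ≥0∞ := if S.Before j then sSup (S.entryTimes j) else 0

open Classical in
/-- The process time `P_j (T)`; it is `∞` if no input fulfils the constraint. -/
def P (j : Fin nc) (T : ℝ≥0∞) : ℝ≥0∞ :=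
  if (S.ctrl j).β ≤ S.ya0 (Sum.inl j) then 0
  else if S.Before j then
    sInf {p | T ≠ ∞ ∧ ∃ u ∈ (S.ctrl j).inputs, S.yb j u T.toReal = (S.ctrl j).α ∧
      ∃ t : ℝ, T.toReal ≤ t ∧ S.ya j u t = (S.ctrl j).β ∧ p = ENNReal.ofReal (t - T.toReal)}
  else
    sInf {p | ∃ u ∈ (S.ctrl j).inputs, ∃ t : ℝ, 0 ≤ t ∧ S.ya j u t = (S.ctrl j).β ∧
      p = ENNReal.ofReal t}

open Classical in
/-- The left end of the idle-time of uncontrolled vehicle `γ`. -/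
def Rbar (γ : Fin nu) : ℝ≥0∞ :=
  if S.yb0 (Sum.inr γ) < (S.unctrl γ).α then
    sInf {T | ∃ t : ℝ, 0 ≤ t ∧ S.ybUn γ t = (S.unctrl γ).α ∧ T = ENNReal.ofReal t}
  else 0

open Classical in
/-- The right end of the idle-time of uncontrolled vehicle `γ`. -/
def Pbar (γ : Fin nu) : ℝ≥0∞ :=
  if (S.unctrl γ).β ≤ S.ya0 (Sum.inr γ) then 0
  else sInf {T | ∃ t : ℝ, 0 ≤ t ∧ S.yaUn γ t = (S.unctrl γ).β ∧ T = ENNReal.ofReal t}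

/-- The maximal process time. -/
def thetaMax : ℝ≥0∞ := ⨆ j, ⨆ T ∈ Set.Icc (S.R j) (S.D j), S.P j T

open Classical in
/-- The controlled vehicles before the intersection, in the order of their numbers. -/
def listM : List (Fin nc) := (List.finRange nc).filter fun j => S.Before j

/-- The time at which the vehicles that are not before the intersection have left it
(`0` if there are none). -/
def Pmax : ℝ≥0∞ := ⨆ j, ⨆ _ : ¬ S.Before j, S.P j 0

/-! ### Bad sets -/

/-- The output configurations with two vehicles, at least one of them controlled, that are in
their intersections `(α_i, b_i)` at the same time. -/
def conflictSet (b : Fin nc ⊕ Fin nu → ℝ) : Set (Fin nc ⊕ Fin nu → ℝ) :=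
  {y | (∀ i, y i ∈ (S.veh i).Y) ∧ ∃ (i : Fin nc ⊕ Fin nu) (j : Fin nc), i ≠ Sum.inl j ∧
    y i ∈ Set.Ioo (S.veh i).α (b i) ∧
    y (Sum.inl j) ∈ Set.Ioo (S.veh (Sum.inl j)).α (b (Sum.inl j))}

/-- The Bad set `B`. -/
def bad : Set (Fin nc ⊕ Fin nu → ℝ) := S.conflictSet fun i => (S.veh i).β

/-- The right ends of the inflated intersections. -/
def betaHat : Fin nc ⊕ Fin nu → ℝ
  | Sum.inl j => (S.ctrl j).α + S.thetaMax.toReal * (S.ctrl j).vmax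
  | Sum.inr γ => (S.unctrl γ).β

/-- The inflated Bad set. -/
def badHat : Set (Fin nc ⊕ Fin nu → ℝ) := S.conflictSet S.betaHat

/-- The initial position estimation `[y^a (0), y^b (0)]`. -/
def positionBox : Set (Fin nc ⊕ Fin nu → ℝ) := Set.Icc S.ya0 S.yb0

/-- The output `y (t, u, w, d, x0)`. -/
def output (u : Fin nc → ℝ → ℝ) (w : Fin nu → ℝ → ℝ) (d : Fin nc ⊕ Fin nu → ℝ → ℝ × ℝ)
    (x0 : Fin nc ⊕ Fin nu → ℝ × ℝ) (t : ℝ) : Fin nc ⊕ Fin nu → ℝ :=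
  fun i => ((S.veh i).traj (Sum.elim u w i) (d i) (x0 i) t).1

/-- The input signal `u` keeps the output outside of `A` at all times, for all driver-inputs,
disturbances and initial states. -/
def Avoids (A : Set (Fin nc ⊕ Fin nu → ℝ)) (u : Fin nc → ℝ → ℝ) : Prop :=
  ∀ w : Fin nu → ℝ → ℝ, (∀ γ, w γ ∈ (S.unctrl γ).inputs) →
  ∀ d : Fin nc ⊕ Fin nu → ℝ → ℝ × ℝ, (∀ i, d i ∈ (S.veh i).dists) →
  ∀ x0 : Fin nc ⊕ Fin nu → ℝ × ℝ, (∀ i, x0 i ∈ Set.Icc (S.xa i) (S.xb i)) →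
  ∀ t, 0 ≤ t → S.output u w d x0 t ∉ A

/-! ### The procedures -/

/-- The uncontrolled vehicles in increasing order of `Rbar`. -/
def idleOrder : List (Fin nu) :=
  (List.finRange nu).insertionSort fun γ γ' => S.Rbar γ ≤ S.Rbar γ'

/-- The inner loop of Scheduling: `T` is moved past the idle-times that it conflicts with. -/
def avoidIdle (j : Fin nc) (T : ℝ≥0∞) : ℝ≥0∞ :=
  S.idleOrder.foldl (fun T γ =>
    if S.Rbar γ ≤ T then max T (S.Pbar γ)
    else if S.Rbar γ < T + S.P j T then S.Pbar γ
    else T) T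

/-- The outer loop of Scheduling: `e` is the time at which the previous vehicle has left the
intersection. -/
def scheduleLoop : ℝ≥0∞ → List (Fin nc) → (Fin nc → ℝ≥0∞) → (Fin nc → ℝ≥0∞)
  | _, [], T => T
  | e, j :: l, T =>
    let Tj := S.avoidIdle j (max (S.R j) e)
    scheduleLoop (Tj + S.P j Tj) l (Function.update T j Tj)

open Classical in
/-- Procedure Scheduling: the schedule (`none` if the answer is no) and the answer. -/
def scheduling (π₀ : List (Fin nc)) : Option (Fin nc → ℝ≥0∞) × Bool :=
  let π := π₀.filter fun j => S.Before j
  let T := S.scheduleLoop S.Pmax π fun _ => 0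
  if ∀ j, T j ≤ S.D j then (some T, true) else (none, false)

open Classical in
/-- Procedure RelaxedExact: the schedule (`none` if there is none), the sequence of the
vehicles before the intersection, and the answer. -/
def relaxedExact : Option (Fin nc → ℝ) × List (Fin nc) × Bool :=
  if (S.positionBox ∩ S.bad).Nonempty then (none, [], false)
  else if ∀ j, ¬ S.Before j then (none, [], true)
  else
    let θ := S.thetaMax.toReal
    let F : List (ℝ × ℝ) := (List.finRange nu).map fun γ =>
      (max ((S.Rbar γ).toReal / θ - 1) 0, (S.Pbar γ).toReal / θ)
    let r : Fin nc → ℝ := fun j => (max (S.R j) S.Pmax).toReal / θ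
    let d : Fin nc → ℝ := fun j => (S.D j).toReal / θ
    match polynomial S.listM r d F with
    | (some t, π, true) => (some fun j => if S.Before j then t j * θ else 0, π, true)
    | (_, π, _) => (none, π, false)

open Classical in
/-- Procedure Approx: the schedule (`none` stands for `∅`) and the answer. -/
def approx : Option (Fin nc → ℝ≥0∞) × Bool :=
  if (S.positionBox ∩ S.bad).Nonempty then (none, false)
  else if ∀ j, (S.ctrl j).α ≤ S.yb0 (Sum.inl j) then (none, true)
  else S.scheduling S.relaxedExact.2.1

/-! ### Standing assumptions -/

/-- The model assumptions. -/
structure Standing : Prop where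
  wellPosed : ∀ i, (S.veh i).WellPosed
  orderPreserving : ∀ i, (S.veh i).OrderPreserving
  positionMonotone : ∀ i, (S.veh i).PositionMonotone
  continuousInInput : ∀ j, (S.ctrl j).ContinuousInInput
  /-- The initial state estimation is a nonempty box of states. -/
  init_le : ∀ i, S.xa i ≤ S.xb i
  init_sub : ∀ i, Set.Icc (S.xa i) (S.xb i) ⊆ (S.veh i).X
  /-- The minima and maxima in the state estimation are attained. -/
  dists_extremes : ∀ i, Vehicle.HasExtremes (S.veh i).dists
  inputs_extremes : ∀ γ, Vehicle.HasExtremes (S.unctrl γ).inputs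
  /-- Every position between the lower and the upper estimate is possible. -/
  interval_ctrl : ∀ j, ∀ u ∈ (S.ctrl j).inputs,
    (S.ctrl j).PositionsInterval {u} (S.xa (Sum.inl j)) (S.xb (Sum.inl j))
  interval_unctrl : ∀ γ,
    (S.unctrl γ).PositionsInterval (S.unctrl γ).inputs (S.xa (Sum.inr γ)) (S.xb (Sum.inr γ))
  /-- The lower position estimate of a controlled vehicle advances at most at the maximal
  speed. -/
  speed_le : ∀ j, ∀ u ∈ (S.ctrl j).inputs, ∀ s t, 0 ≤ s → s ≤ t →
    S.ya j u t - S.ya j u s ≤ (S.ctrl j).vmax * (t - s)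

/-- The scheduling parameters are well defined: they are finite, and the upper position
estimate of a vehicle is at the beginning of the intersection at no more than one time. -/
structure ParametersDefined : Prop where
  R_ne : ∀ j, S.R j ≠ ∞
  D_ne : ∀ j, S.D j ≠ ∞
  Rbar_ne : ∀ γ, S.Rbar γ ≠ ∞
  Pbar_ne : ∀ γ, S.Pbar γ ≠ ∞
  theta_ne : S.thetaMax ≠ ∞
  entry_unique : ∀ j, ∀ u ∈ (S.ctrl j).inputs, ∀ s t, 0 ≤ s → 0 ≤ t →
    S.yb j u s = (S.ctrl j).α → S.yb j u t = (S.ctrl j).α → s = t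
  entry_unique_un : ∀ γ, ∀ s t, 0 ≤ s → 0 ≤ t →
    S.ybUn γ s = (S.unctrl γ).α → S.ybUn γ t = (S.unctrl γ).α → s = t

end Instance

end Intersection

end

namespace Intersection

/-! Suppose an input `u` avoids the inflated Bad set, and write θ for `thetaMax`. If a vehicle
before its intersection enters at time e under `u`, its lower estimate is then at most α and gains
at most `vmax` per unit of time, so the vehicle occupies its inflated intersection throughout (e, e
+ θ). Two intersections occupied at once, one of them by a controlled vehicle, yield a configuration
in the inflated Bad set (`Avoids.not_occupied`). Hence the entry times divided by θ form a feasible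
schedule of the unit jobs (`feasible_of_avoids`).

Polynomial then returns the order of some feasible schedule t (`polynomial_order`), by the forbidden
region argument. Packing jobs with a common deadline backwards bounds the time at which the first of
them starts. If this critical time c, for jobs released from r on, is less than r + 1, no feasible
schedule starts a job in (c - 1, r), so forbidding that interval costs nothing (`declInv_declLoop`).
Once these intervals are forbidden, the earliest-deadline rule cannot fail, since a less urgent job
never delays urgent jobs that are about to be released (`generate_spec`).

Along this order Scheduling starts no vehicle later than θ t, since the true process times are at
most θ (`scheduleLoop_le`). So all deadlines are met and the answer is *yes* (`scheduling_yes`). An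
initial box that meets the Bad set is incompatible with `u` as well (`not_avoids_of_initial`), so
Approx cannot answer *no*. -/

/-! ## Correctness of procedure Polynomial -/

/-- The point `x` lies in none of the open intervals in `F`. -/
def Outside (F : List (ℝ × ℝ)) (x : ℝ) : Prop := ∀ I ∈ F, ¬ (I.1 < x ∧ x < I.2)

lemma Outside.mono {F G : List (ℝ × ℝ)} {x : ℝ} (h : F ⊆ G) (hx : Outside G x) : Outside F x :=
  fun I hI => hx I (h hI)

/-- Each move to a left end lowers the number of intervals whose left end is below the current
point, so `F.length` rounds suffice. A move only crosses the interior of one interval, hence skips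
no outside point. -/
lemma leaveDown_spec (F : List (ℝ × ℝ)) (c : ℝ) :
    leaveDown F c ≤ c ∧ Outside F (leaveDown F c) ∧
      ∀ x, x ≤ c → Outside F x → x ≤ leaveDown F c := by
  classical
  unfold leaveDown
  set g : ℝ → ℝ := fun c => match F.find? (fun I => I.1 < c ∧ c < I.2) with
    | some I => I.1
    | none => c with hg
  have key : ∀ n c, (F.toFinset.filter fun I => I.1 < c).card ≤ n →
      g^[n] c ≤ c ∧ Outside F (g^[n] c) ∧ ∀ x, x ≤ c → Outside F x → x ≤ g^[n] c := by
    intro n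
    induction n with
    | zero =>
      intro c h
      refine ⟨le_rfl, fun I hI hc => ?_, fun x hx _ => hx⟩
      rw [Function.iterate_zero_apply] at hc
      have : I ∈ F.toFinset.filter fun I => I.1 < c := by simp [hI, hc.1]
      have := Finset.card_pos.2 ⟨I, this⟩
      omega
    | succ n ih =>
      intro c h
      rw [Function.iterate_succ_apply]
      rcases hf : F.find? (fun I => I.1 < c ∧ c < I.2) with _ | I
      · have hgc : g c = c := by simp only [hg, hf]
        have ho : Outside F c := by
          intro I hI hc
          have := List.find?_eq_none.1 hf I hI
          simp [hc] at this
        rw [hgc, Function.iterate_fixed hgc]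
        exact ⟨le_rfl, ho, fun x hx _ => hx⟩
      · have hgc : g c = I.1 := by simp only [hg, hf]
        have hI : I ∈ F := List.mem_of_find?_eq_some hf
        have hc : I.1 < c ∧ c < I.2 := by simpa using List.find?_some hf
        have hlt : (F.toFinset.filter fun J => J.1 < I.1).card <
            (F.toFinset.filter fun J => J.1 < c).card := by
          apply Finset.card_lt_card
          refine ⟨?_, ?_⟩
          · intro J hJ
            simp only [Finset.mem_filter] at hJ ⊢
            exact ⟨hJ.1, hJ.2.trans hc.1⟩
          · intro hsub
            have : I ∈ F.toFinset.filter fun J => J.1 < I.1 := hsub (by simp [hI, hc.1])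
            simp at this
        rw [hgc]
        obtain ⟨h1, h2, h3⟩ := ih I.1 (by omega)
        refine ⟨h1.trans hc.1.le, h2, fun x hx ho => h3 x ?_ ho⟩
        by_contra hlt
        exact ho I hI ⟨not_le.1 hlt, hx.trans_lt hc.2⟩
  exact key _ _ ((Finset.card_filter_le _ _).trans (List.toFinset_card_le F))

lemma leaveUp_spec (F : List (ℝ × ℝ)) (c : ℝ) :
    c ≤ leaveUp F c ∧ Outside F (leaveUp F c) ∧
      ∀ x, c ≤ x → Outside F x → leaveUp F c ≤ x := by
  classical
  unfold leaveUp
  set g : ℝ → ℝ := fun s => match F.find? (fun I => I.1 < s ∧ s < I.2) with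
    | some I => I.2
    | none => s with hg
  have key : ∀ n c, (F.toFinset.filter fun I => c < I.2).card ≤ n →
      c ≤ g^[n] c ∧ Outside F (g^[n] c) ∧ ∀ x, c ≤ x → Outside F x → g^[n] c ≤ x := by
    intro n
    induction n with
    | zero =>
      intro c h
      refine ⟨le_rfl, fun I hI hc => ?_, fun x hx _ => hx⟩
      rw [Function.iterate_zero_apply] at hc
      have : I ∈ F.toFinset.filter fun I => c < I.2 := by simp [hI, hc.2]
      have := Finset.card_pos.2 ⟨I, this⟩
      omega
    | succ n ih =>
      intro c h
      rw [Function.iterate_succ_apply]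
      rcases hf : F.find? (fun I => I.1 < c ∧ c < I.2) with _ | I
      · have hgc : g c = c := by simp only [hg, hf]
        have ho : Outside F c := by
          intro I hI hc
          have := List.find?_eq_none.1 hf I hI
          simp [hc] at this
        rw [hgc, Function.iterate_fixed hgc]
        exact ⟨le_rfl, ho, fun x hx _ => hx⟩
      · have hgc : g c = I.2 := by simp only [hg, hf]
        have hI : I ∈ F := List.mem_of_find?_eq_some hf
        have hc : I.1 < c ∧ c < I.2 := by simpa using List.find?_some hf
        have hlt : (F.toFinset.filter fun J => I.2 < J.2).card <
            (F.toFinset.filter fun J => c < J.2).card := by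
          apply Finset.card_lt_card
          refine ⟨?_, ?_⟩
          · intro J hJ
            simp only [Finset.mem_filter] at hJ ⊢
            exact ⟨hJ.1, hc.2.trans hJ.2⟩
          · intro hsub
            have : I ∈ F.toFinset.filter fun J => I.2 < J.2 := hsub (by simp [hI, hc.2])
            simp at this
        rw [hgc]
        obtain ⟨h1, h2, h3⟩ := ih I.2 (by omega)
        refine ⟨hc.2.le.trans h1, h2, fun x hx ho => h3 x ?_ ho⟩
        by_contra hlt
        exact ho I hI ⟨hc.1.trans_le hx, not_le.1 hlt⟩
  exact key _ _ ((Finset.card_filter_le _ _).trans (List.toFinset_card_le F))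

lemma leaveDown_congr {F G : List (ℝ × ℝ)} {c : ℝ} (h : F ⊆ G)
    (h' : ∀ I ∈ G, I ∈ F ∨ I.2 ≤ leaveDown F c) : leaveDown G c = leaveDown F c := by
  obtain ⟨hF1, hF2, hF3⟩ := leaveDown_spec F c
  obtain ⟨hG1, hG2, hG3⟩ := leaveDown_spec G c
  refine le_antisymm (hF3 _ hG1 (hG2.mono h)) (hG3 _ hF1 fun I hI hx => ?_)
  rcases h' I hI with h1 | h1
  · exact hF2 I h1 hx
  · exact absurd hx.2 (not_lt.2 h1)

/-! ### Backward packing of unit jobs -/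

/-- Backward packing: `backPack F δ n` is the latest time at which `n` jobs of unit length with
deadline `δ` can begin to be executed, if no job may start inside of an interval in `F`. -/
noncomputable def backPack (F : List (ℝ × ℝ)) (δ : ℝ) : ℕ → ℝ
  -- With this value the first job is moved down from `δ` itself.
  | 0 => δ + 1
  | n + 1 => leaveDown F (backPack F δ n - 1)

lemma backPack_succ_le (F : List (ℝ × ℝ)) (δ : ℝ) (n : ℕ) :
    backPack F δ (n + 1) ≤ backPack F δ n - 1 := (leaveDown_spec F _).1

lemma backPack_outside (F : List (ℝ × ℝ)) (δ : ℝ) {n : ℕ} (hn : 0 < n) :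
    Outside F (backPack F δ n) := by
  obtain ⟨m, rfl⟩ := Nat.exists_eq_succ_of_ne_zero hn.ne'
  exact (leaveDown_spec F _).2.1

lemma backPack_antitone (F : List (ℝ × ℝ)) (δ : ℝ) : Antitone (backPack F δ) :=
  antitone_nat_of_succ_le fun n => by linarith [backPack_succ_le F δ n]

lemma backPack_le (F : List (ℝ × ℝ)) (δ : ℝ) {n : ℕ} (hn : 0 < n) : backPack F δ n ≤ δ := by
  have h1 := backPack_antitone F δ (Nat.succ_le_of_lt hn)
  have h2 := backPack_succ_le F δ 0
  simp only [backPack] at h1 h2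
  linarith

/-- The declaration loop runs backwards in release time, so the regions added later end before the
packings already computed and leave them unchanged. -/
lemma backPack_congr {F G : List (ℝ × ℝ)} {δ : ℝ} {n : ℕ} (h : F ⊆ G)
    (h' : ∀ I ∈ G, I ∈ F ∨ I.2 ≤ backPack F δ n) : backPack G δ n = backPack F δ n := by
  have key : ∀ m ≤ n, backPack G δ m = backPack F δ m := by
    intro m
    induction m with
    | zero => intro _; rfl
    | succ m ih =>
      intro hm
      simp only [backPack]
      rw [ih (by omega)]
      exact leaveDown_congr h fun I hI =>
        (h' I hI).imp_right fun hle => hle.trans (backPack_antitone F δ hm)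
  exact key n le_rfl

/-- Of `n` separated starting times before `δ` outside of `F`, the first is at most
`backPack F δ n`. -/
lemma exists_le_backPack {ι : Type*} [DecidableEq ι] {F : List (ℝ × ℝ)} {δ : ℝ} {τ : ι → ℝ} :
    ∀ {n : ℕ} {A : Finset ι}, A.card = n → A.Nonempty → (∀ a ∈ A, Outside F (τ a)) →
      (∀ a ∈ A, τ a ≤ δ) → (∀ a ∈ A, ∀ b ∈ A, a ≠ b → 1 ≤ |τ a - τ b|) →
      ∃ a ∈ A, τ a ≤ backPack F δ n := by
  intro n
  induction n with
  | zero =>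
    intro A hA hne
    exact absurd hA hne.card_pos.ne'
  | succ n ih =>
    intro A hA hne ho hδ hsep
    -- The earliest job precedes each of the others by at least one unit, and by induction one of
    -- these starts by `backPack F δ n`.
    obtain ⟨a, ha, hmin⟩ := A.exists_min_image τ hne
    refine ⟨a, ha, (leaveDown_spec F _).2.2 _ ?_ (ho a ha)⟩
    rcases (A.erase a).eq_empty_or_nonempty with he | he
    · have : n = 0 := by
        have := Finset.card_erase_of_mem ha
        rw [he, hA] at this
        simpa using this.symm
      subst this
      simpa [backPack] using hδ a ha
    · obtain ⟨b, hb, hle⟩ := ih (A := A.erase a) (by rw [Finset.card_erase_of_mem ha, hA]; rfl) he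
        (fun c hc => ho c (Finset.mem_of_mem_erase hc))
        (fun c hc => hδ c (Finset.mem_of_mem_erase hc))
        (fun c hc e he => hsep c (Finset.mem_of_mem_erase hc) e (Finset.mem_of_mem_erase he))
      have hbA := Finset.mem_of_mem_erase hb
      have h1 := hsep a ha b hbA (Finset.ne_of_mem_erase hb).symm
      rw [abs_sub_comm, abs_of_nonneg (sub_nonneg.2 (hmin b hbA))] at h1
      linarith

/-! ### Forbidden region declaration -/

section Declaration

variable {ι : Type*}

/-- A schedule for the unit jobs in `jobs` that respects release times, deadlines and initial
forbidden regions. -/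
structure Feasible (jobs : List ι) (r d : ι → ℝ) (F : List (ℝ × ℝ)) (τ : ι → ℝ) : Prop where
  release : ∀ j ∈ jobs, r j ≤ τ j
  deadline : ∀ j ∈ jobs, τ j ≤ d j
  outside : ∀ j ∈ jobs, Outside F (τ j)
  separated : ∀ i ∈ jobs, ∀ j ∈ jobs, i ≠ j → 1 ≤ |τ i - τ j|

/-- The number of jobs in `l` with deadline at most `δ`. -/
noncomputable def cnt (d : ι → ℝ) (δ : ℝ) (l : List ι) : ℕ := l.countP fun j => d j ≤ δ

lemma cnt_pos {d : ι → ℝ} {δ : ℝ} {l : List ι} : 0 < cnt d δ l ↔ ∃ j ∈ l, d j ≤ δ := by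
  simp [cnt, List.countP_pos_iff]

lemma Feasible.exists_le_backPack [DecidableEq ι] {jobs : List ι} {r d : ι → ℝ} {F : List (ℝ × ℝ)} {τ : ι → ℝ}
    (hτ : Feasible jobs r d F τ) {l : List ι} (hl : l ⊆ jobs) (hnd : l.Nodup) {δ : ℝ}
    (hc : 0 < cnt d δ l) : ∃ a ∈ l, τ a ≤ backPack F δ (cnt d δ l) := by
  have hmem : ∀ a, a ∈ (l.filter fun j => d j ≤ δ).toFinset → a ∈ l ∧ d a ≤ δ := by simp
  obtain ⟨k, hk, hkδ⟩ := cnt_pos.1 hc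
  obtain ⟨a, ha, hle⟩ := Intersection.exists_le_backPack (F := F) (δ := δ) (τ := τ)
    (n := cnt d δ l) (A := (l.filter fun j => d j ≤ δ).toFinset)
    (by rw [List.toFinset_card_of_nodup (hnd.filter _), cnt, List.countP_eq_length_filter])
    ⟨k, by simp [hk, hkδ]⟩
    (fun a ha => hτ.outside a (hl (hmem a ha).1))
    (fun a ha => (hτ.deadline a (hl (hmem a ha).1)).trans (hmem a ha).2)
    (fun a ha b hb => hτ.separated a (hl (hmem a ha).1) b (hl (hmem b hb).1))
  exact ⟨a, (hmem a ha).1, hle⟩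

lemma min?_filterMap_spec {jobs : List ι} {cs : ι → Option ℝ} {x : ℝ}
    (h : (jobs.filterMap cs).min? = some x) :
    (∃ j ∈ jobs, cs j = some x) ∧ ∀ j ∈ jobs, ∀ c, cs j = some c → x ≤ c := by
  rw [List.min?_eq_some_iff] at h
  exact ⟨List.mem_filterMap.1 h.1, fun j hj c hc => h.2 c (List.mem_filterMap.2 ⟨j, hj, hc⟩)⟩

/-- What the declaration loop has achieved after it has treated the jobs in `l`. -/
structure DeclInv (jobs : List ι) (r d : ι → ℝ) (F₀ : List (ℝ × ℝ)) (τ : ι → ℝ) (l : List ι)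
    (st : DeclState ι) : Prop where
  feasible : Feasible jobs r d st.F τ
  cs_eq : ∀ j, st.cs j =
    if cnt d (d j) l = 0 then none else some (backPack st.F (d j) (cnt d (d j) l))
  c_le : ∀ x, st.c = some x → ∃ a ∈ l, τ a ≤ x
  subset : F₀ ⊆ st.F

lemma declStep_cs (jobs : List ι) (r d : ι → ℝ) (p : Option ι) (i : ι) (st : DeclState ι)
    (j : ι) : (declStep jobs r d p i st).cs j =
      if d i ≤ d j then some (leaveDown st.F ((st.cs j).elim (d j) (· - 1))) else st.cs j := by
  have : (declStep jobs r d p i st).cs j = if d i ≤ d j then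
      some (leaveDown st.F (match st.cs j with
        | none => d j
        | some c => c - 1)) else st.cs j := by
    unfold declStep
    dsimp only
    split <;> rfl
  rw [this]
  cases st.cs j <;> rfl

lemma declStep_c (jobs : List ι) (r d : ι → ℝ) (p : Option ι) (i : ι) (st : DeclState ι)
    [Decidable (∀ q ∈ p, r q < r i)] : (declStep jobs r d p i st).c =
      if ∀ q ∈ p, r q < r i then (jobs.filterMap (declStep jobs r d p i st).cs).min?
      else st.c := by
  unfold declStep
  dsimp only
  split <;> rename_i h <;> dsimp only <;> rw [← h] <;> congr

lemma declStep_F (jobs : List ι) (r d : ι → ℝ) (p : Option ι) (i : ι) (st : DeclState ι) :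
    (declStep jobs r d p i st).F = (declStep jobs r d p i st).c.elim st.F fun x =>
      if r i ≤ x ∧ x < r i + 1 then (x - 1, r i) :: st.F else st.F := by
  unfold declStep
  dsimp only
  split <;> rfl

lemma declLoop_F (jobs : List ι) (r d : ι → ℝ) (F₀ : List (ℝ × ℝ)) (p : Option ι) (i : ι)
    (l : List ι) :
    (declLoop jobs r d F₀ (some i) l).F ⊆ (declLoop jobs r d F₀ p (i :: l)).F ∧
    ∀ I ∈ (declLoop jobs r d F₀ p (i :: l)).F,
      I ∈ (declLoop jobs r d F₀ (some i) l).F ∨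
        ∃ x, (declLoop jobs r d F₀ p (i :: l)).c = some x ∧ I = (x - 1, r i) := by
  simp only [declLoop]
  rw [declStep_F]
  rcases (declStep jobs r d p i (declLoop jobs r d F₀ (some i) l)).c with _ | x
  · exact ⟨fun _ h => h, fun I h => Or.inl h⟩
  · dsimp only [Option.elim]
    split_ifs
    · refine ⟨fun _ h => List.mem_cons_of_mem _ h, fun I h => ?_⟩
      rcases List.mem_cons.1 h with rfl | h
      · exact Or.inr ⟨x, rfl, rfl⟩
      · exact Or.inl h
    · exact ⟨fun _ h => h, fun I h => Or.inl h⟩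

/-- The jobs in `pre` are treated after those in `l`, and a region declared for a job ends at its
release time, which is below `ρ`. The job just before `l` is `p'`. -/
lemma declLoop_append_F (jobs : List ι) (r d : ι → ℝ) (F₀ : List (ℝ × ℝ)) {ρ : ℝ} (l : List ι) :
    ∀ (pre : List ι) (p : Option ι), (∀ q ∈ p, r q < ρ) → (∀ q ∈ pre, r q < ρ) →
    ∃ p' : Option ι, (∀ q ∈ p', r q < ρ) ∧
      (declLoop jobs r d F₀ p' l).F ⊆ (declLoop jobs r d F₀ p (pre ++ l)).F ∧
      ∀ I ∈ (declLoop jobs r d F₀ p (pre ++ l)).F,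
        I ∈ (declLoop jobs r d F₀ p' l).F ∨ I.2 ≤ ρ := by
  intro pre
  induction pre with
  | nil => exact fun p hp _ => ⟨p, hp, fun _ h => h, fun I h => Or.inl h⟩
  | cons i pre ih =>
    intro p _ hpre
    obtain ⟨p', h1, h2, h3⟩ := ih (some i) (by simpa using hpre i (by simp))
      fun q hq => hpre q (by simp [hq])
    obtain ⟨h4, h5⟩ := declLoop_F jobs r d F₀ p i (pre ++ l)
    refine ⟨p', h1, fun _ h => h4 (h2 h), fun I hI => ?_⟩
    rcases h5 I hI with h | h
    · exact h3 I h
    · obtain ⟨x, -, rfl⟩ := h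
      exact Or.inr (hpre i (by simp)).le

lemma backPack_cons_congr {F G : List (ℝ × ℝ)} {δ ρ : ℝ} {n : ℕ} (h : F ⊆ G)
    (h' : ∀ I ∈ G, I ∈ F ∨ I.2 ≤ ρ) (hρ : ρ ≤ backPack F δ n) :
    backPack G δ n = backPack F δ n :=
  backPack_congr h fun I hI => (h' I hI).imp_right fun hle => hle.trans hρ

/-- A declared region does not exclude `τ`: some treated job `a` starts in `[r i, x]`, where `x` is
the critical time, and a start in `(x - 1, r i)` would be less than one unit before it. The numbers
`c_j` remain backward packings for the enlarged list of regions, because the new region ends at `r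
i`, and `r i ≤ τ a` is below every packing of treated jobs. -/
lemma declInv_declLoop [DecidableEq ι] {jobs : List ι} {r d : ι → ℝ} {F₀ : List (ℝ × ℝ)} {τ : ι → ℝ}
    (hτ : Feasible jobs r d F₀ τ) :
    ∀ (l : List ι) (p : Option ι), l ⊆ jobs → l.Nodup → l.Pairwise (fun i j => r i ≤ r j) →
      DeclInv jobs r d F₀ τ l (declLoop jobs r d F₀ p l) := by
  intro l
  induction l with
  | nil =>
    intro p _ _ _
    exact ⟨hτ, fun j => by simp [declLoop, cnt], fun x hx => by simp [declLoop] at hx,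
      fun _ h => h⟩
  | cons i l ih =>
    intro p hl hnd hs
    have hIH := ih (some i) (fun a ha => hl (by simp [ha])) (List.nodup_cons.1 hnd).2
      (List.pairwise_cons.1 hs).2
    have hri : ∀ a ∈ i :: l, r i ≤ τ a := by
      intro a ha
      refine le_trans ?_ (hτ.release a (hl ha))
      rcases List.mem_cons.1 ha with rfl | ha
      · exact le_rfl
      · exact (List.pairwise_cons.1 hs).1 a ha
    obtain ⟨hsub, hnew⟩ := declLoop_F jobs r d F₀ p i l
    have hcs : ∀ j, (declLoop jobs r d F₀ p (i :: l)).cs j =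
        if cnt d (d j) (i :: l) = 0 then none else
          some (backPack (declLoop jobs r d F₀ (some i) l).F (d j) (cnt d (d j) (i :: l))) := by
      intro j
      simp only [declLoop]
      rw [declStep_cs, hIH.cs_eq j]
      by_cases hij : d i ≤ d j
      · have hc : cnt d (d j) (i :: l) = cnt d (d j) l + 1 := by simp [cnt, hij]
        rw [if_pos hij, hc, if_neg (Nat.succ_ne_zero _)]
        by_cases h0 : cnt d (d j) l = 0
        · simp [h0, backPack]
        · rw [if_neg h0]
          rfl
      · have hc : cnt d (d j) (i :: l) = cnt d (d j) l := by simp [cnt, hij]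
        rw [if_neg hij, hc]
    set st := declLoop jobs r d F₀ (some i) l with hst
    have hnew' : ∀ I ∈ (declLoop jobs r d F₀ p (i :: l)).F, I ∈ st.F ∨ I.2 ≤ r i := by
      intro I hI
      refine (hnew I hI).imp_right ?_
      rintro ⟨x, -, rfl⟩
      exact le_rfl
    have hback : ∀ j, 0 < cnt d (d j) (i :: l) →
        ∃ a ∈ i :: l, τ a ≤ backPack st.F (d j) (cnt d (d j) (i :: l)) :=
      fun j hj => hIH.feasible.exists_le_backPack hl hnd hj
    have hcle : ∀ x, (declLoop jobs r d F₀ p (i :: l)).c = some x →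
        ∃ a ∈ i :: l, τ a ≤ x := by
      intro x hx
      have hx' := hx
      simp only [declLoop] at hx'
      rw [declStep_c] at hx'
      split_ifs at hx' with hp
      · obtain ⟨⟨j, hj, hjx⟩, -⟩ := min?_filterMap_spec hx'
        rw [← declLoop, hcs j] at hjx
        split_ifs at hjx with h0
        obtain ⟨a, ha, hle⟩ := hback j (Nat.pos_of_ne_zero h0)
        simp only [Option.some.injEq] at hjx
        exact ⟨a, ha, hle.trans_eq hjx⟩
      -- Within a group of equal release times the critical time is inherited, and so is its bound.
      · obtain ⟨a, ha, hle⟩ := hIH.c_le x hx'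
        exact ⟨a, by simp [ha], hle⟩
    refine ⟨⟨hτ.release, hτ.deadline, ?_, hτ.separated⟩, ?_, hcle, fun _ h => hsub (hIH.subset h)⟩
    · intro k hk I hI hx
      rcases hnew I hI with hIst | ⟨x, hcx, rfl⟩
      · exact hIH.feasible.outside k hk I hIst hx
      obtain ⟨a, ha, hax⟩ := hcle x hcx
      have h1 := hri a ha
      dsimp only at hx
      have hne : a ≠ k := by
        rintro rfl
        linarith [hx.2]
      have h2 := hτ.separated a (hl ha) k hk hne
      rw [abs_of_nonneg (by linarith [hx.2])] at h2
      linarith [hx.1]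
    · intro j
      rw [hcs j]
      by_cases h0 : cnt d (d j) (i :: l) = 0
      · simp [h0]
      · rw [if_neg h0, if_neg h0]
        obtain ⟨a, ha, hle⟩ := hback j (Nat.pos_of_ne_zero h0)
        rw [backPack_cons_congr hsub hnew' ((hri a ha).trans hle)]

/-- At the first job of a group of equal release times, a forbidden region is declared if the
critical time is less than one time unit after the release. -/
lemma declLoop_region [DecidableEq ι] {jobs : List ι} {r d : ι → ℝ} {F₀ : List (ℝ × ℝ)} {τ : ι → ℝ}
    (hτ : Feasible jobs r d F₀ τ) {l : List ι} {p : Option ι} {i : ι} (hl : i :: l ⊆ jobs)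
    (hnd : (i :: l).Nodup) (hs : (i :: l).Pairwise (fun i j => r i ≤ r j))
    (hp : ∀ q ∈ p, r q < r i) {k : ι} (hk : k ∈ jobs) (hc : 0 < cnt d (d k) (i :: l))
    (hlt : backPack (declLoop jobs r d F₀ p (i :: l)).F (d k) (cnt d (d k) (i :: l)) < r i + 1) :
    ∃ x ≤ backPack (declLoop jobs r d F₀ p (i :: l)).F (d k) (cnt d (d k) (i :: l)),
      (x - 1, r i) ∈ (declLoop jobs r d F₀ p (i :: l)).F := by
  have hI := declInv_declLoop hτ (i :: l) p hl hnd hs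
  have hcsk := hI.cs_eq k
  rw [if_neg hc.ne'] at hcsk
  have hcc := hI.c_le
  simp only [declLoop] at hcsk hcc hlt ⊢
  set st := declStep jobs r d p i (declLoop jobs r d F₀ (some i) l) with hst
  have hmin : st.c = (jobs.filterMap st.cs).min? := by
    rw [hst, declStep_c, if_pos hp]
  obtain ⟨x, hx⟩ : ∃ x, st.c = some x := by
    refine Option.isSome_iff_exists.1 ?_
    rw [hmin]
    exact List.isSome_min?_of_mem (List.mem_filterMap.2 ⟨k, hk, hcsk⟩)
  have hxb := (min?_filterMap_spec (hmin.symm.trans hx)).2 k hk _ hcsk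
  refine ⟨x, hxb, ?_⟩
  obtain ⟨a, ha, hax⟩ := hcc x hx
  have h1 : r i ≤ r a := by
    rcases List.mem_cons.1 ha with rfl | ha
    · exact le_rfl
    · exact (List.pairwise_cons.1 hs).1 a ha
  have h2 := hτ.release a (hl ha)
  have hF := declStep_F jobs r d p i (declLoop jobs r d F₀ (some i) l)
  -- The region is really added: `r i ≤ r a ≤ τ a ≤ x`, and `x`, being the minimum, is at most the
  -- packing, which is below `r i + 1`.
  rw [← hst, hx, Option.elim_some, if_pos ⟨by linarith, by linarith⟩] at hF
  rw [hF]
  simp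

end Declaration

/-! ### Schedule generation -/

section Generation

variable {ι : Type*} [DecidableEq ι]

/-- The forbidden regions in `F` bound backward packings from below and announce the tight
ones. -/
def Announced (jobs : List ι) (r d : ι → ℝ) (F : List (ℝ × ℝ)) : Prop :=
  ∀ k ∈ jobs, ∀ A : List ι, A.Nodup → A ⊆ jobs → ∀ a ∈ A, (∀ j ∈ A, d j ≤ d k ∧ r a ≤ r j) →
    r a ≤ backPack F (d k) A.length ∧
    (backPack F (d k) A.length < r a + 1 → ∃ x ≤ backPack F (d k) A.length, (x - 1, r a) ∈ F)

/-- Consider the pass for the first job in `σ` that is not released before `r a`. The critical time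
is recomputed there and takes all of `A` into account, while the regions declared afterwards end by
`r a` and do not affect the packing. -/
lemma announced_declLoop {jobs σ : List ι} {r d : ι → ℝ} {F₀ : List (ℝ × ℝ)} {τ : ι → ℝ}
    (hτ : Feasible jobs r d F₀ τ) (hσ : σ.Perm jobs) (hnd : jobs.Nodup)
    (hs : σ.Pairwise fun i j => r i ≤ r j) :
    Announced jobs r d (declLoop jobs r d F₀ none σ).F := by
  intro k hk A hA hAj a ha hAk
  have hσj : σ ⊆ jobs := hσ.subset
  have hσnd : σ.Nodup := hσ.nodup_iff.2 hnd
  have hI := declInv_declLoop hτ σ none hσj hσnd hs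
  have hcnt : cnt d (d k) A = A.length := by
    simpa [cnt, List.countP_eq_length] using fun j hj => (hAk j hj).1
  refine ⟨?_, fun hlt => ?_⟩
  · obtain ⟨b, hb, hle⟩ := hI.feasible.exists_le_backPack hAj hA (δ := d k)
      (by rw [hcnt]; exact List.length_pos_of_mem ha)
    rw [hcnt] at hle
    exact ((hAk b hb).2.trans (hτ.release b (hAj hb))).trans hle
  · have hsplit := List.takeWhile_append_dropWhile (p := fun j => decide (r j < r a)) (l := σ)
    set pre := σ.takeWhile fun j => decide (r j < r a) with hpre
    have hpre' : ∀ q ∈ pre, r q < r a := fun q hq => by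
      simpa using List.mem_takeWhile_imp hq
    have hdrop : ∀ j ∈ jobs, r a ≤ r j → j ∈ σ.dropWhile fun j => decide (r j < r a) := by
      intro j hj hle
      have : j ∈ σ := hσ.symm.subset hj
      rw [← hsplit] at this
      exact (List.mem_append.1 this).resolve_left fun h => absurd (hpre' j h) (not_lt.2 hle)
    have hhead : ∀ i l, (σ.dropWhile fun j => decide (r j < r a)) = i :: l → r a ≤ r i := by
      intro i l h
      have := List.head_dropWhile_not (fun j => decide (r j < r a)) (l := σ) (by simp [h])
      simpa [h] using this
    rcases hd : σ.dropWhile fun j => decide (r j < r a) with _ | ⟨i, l⟩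
    · have := hdrop a (hAj ha) le_rfl
      simp [hd] at this
    rw [hd] at hsplit hdrop
    have hsub : (i :: l).Sublist σ := hd ▸ List.dropWhile_sublist _
    have hil := hs.sublist hsub
    have hri : r i = r a := by
      refine le_antisymm ?_ (hhead i l hd)
      rcases List.mem_cons.1 (hdrop a (hAj ha) le_rfl) with h | h
      · rw [h]
      · exact (List.pairwise_cons.1 hil).1 a h
    -- The loop may count jobs outside `A`; as packings are antitone in the number of jobs, its
    -- critical time is still at most that of `A`.
    have hN : A.length ≤ cnt d (d k) (i :: l) := by
      rw [cnt, List.countP_eq_length_filter]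
      refine (hA.subperm fun j hj => ?_).length_le
      simp only [List.mem_filter, decide_eq_true_eq]
      exact ⟨hdrop j (hAj hj) (hAk j hj).2, (hAk j hj).1⟩
    have hNpos := (List.length_pos_of_mem ha).trans_le hN
    obtain ⟨p', hp', hF1, hF2⟩ := declLoop_append_F jobs r d F₀ (ρ := r a) (i :: l) pre none
      (by simp) hpre'
    rw [hsplit] at hF1 hF2
    have hI' := declInv_declLoop hτ (i :: l) p' (fun _ h => hσj (hsub.subset h))
      (hsub.nodup hσnd) hil
    obtain ⟨b, hb, hle⟩ := hI'.feasible.exists_le_backPack (fun _ h => hσj (hsub.subset h))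
      (hsub.nodup hσnd) hNpos
    have hrb : r a ≤ r b := by
      rw [← hri]
      rcases List.mem_cons.1 hb with rfl | h
      · exact le_rfl
      · exact (List.pairwise_cons.1 hil).1 b h
    have hcongr := backPack_cons_congr hF1 hF2
      ((hrb.trans (hτ.release b (hσj (hsub.subset hb)))).trans hle)
    have hanti := backPack_antitone (declLoop jobs r d F₀ none σ).F (d k) hN
    obtain ⟨x, hx, hxF⟩ := declLoop_region hτ (fun _ h => hσj (hsub.subset h))
      (hsub.nodup hσnd) hil (p := p') (by rwa [hri]) hk hNpos
      (by rw [hri, ← hcongr]; exact hanti.trans_lt hlt)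
    rw [← hcongr] at hx
    exact ⟨x, hx.trans hanti, hF1 (hri ▸ hxF)⟩

/-- Invariant: for every deadline, the packing of the remaining jobs due by then begins no earlier
than `s`. Applied to the deadline of the selected job, it shows that this job starts in time. -/
lemma generate_spec {jobs : List ι} {r d : ι → ℝ} {F : List (ℝ × ℝ)}
    (hF : Announced jobs r d F) :
    ∀ (n : ℕ) (s : ℝ) (B : List ι) (t : ι → ℝ), B.length = n → B.Nodup → B ⊆ jobs →
      (∀ k ∈ jobs, 0 < cnt d (d k) B → s ≤ backPack F (d k) (cnt d (d k) B)) →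
      (∀ j, j ∉ B → generate F r d n s B t j = t j) ∧
      (∀ j ∈ B, s ≤ generate F r d n s B t j) ∧
      Feasible B r d F (generate F r d n s B t) := by
  intro n
  induction n with
  | zero =>
    intro s B t hB _ _ _
    obtain rfl := List.eq_nil_of_length_eq_zero hB
    exact ⟨fun _ _ => rfl, by simp, by simp, by simp, by simp, by simp⟩
  | succ n ih =>
    intro s B t hB hnd hBj hΦ
    have hBne : B ≠ [] := by
      rintro rfl
      simp at hB
    rw [generate]
    rcases hk : B.argmin r with _ | k
    · exact absurd (List.argmin_eq_none.1 hk) hBne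
    have hkB : k ∈ B := List.argmin_mem hk
    have hkr : ∀ j ∈ B, r k ≤ r j := fun j hj => List.le_of_mem_argmin hj hk
    dsimp only
    obtain ⟨hs1, hs2, hs3⟩ := leaveUp_spec F (max s (r k))
    set s' := leaveUp F (max s (r k)) with hs'
    rcases hj : (B.filter fun l => r l ≤ s').argmin d with _ | j
    · have := List.argmin_eq_none.1 hj
      rw [List.filter_eq_nil_iff] at this
      exact absurd ((le_max_right _ _).trans hs1) (by simpa using this k hkB)
    have hjA := List.argmin_mem hj
    simp only [List.mem_filter, decide_eq_true_eq] at hjA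
    obtain ⟨hjB, hjr⟩ := hjA
    have hjd : ∀ l ∈ B, r l ≤ s' → d j ≤ d l := fun l hl hls =>
      List.le_of_mem_argmin (by simp [hl, hls]) hj
    dsimp only
    have hann : ∀ m ∈ jobs, 0 < cnt d (d m) B → ∃ a ∈ B, d a ≤ d m ∧
        (∀ l ∈ B, d l ≤ d m → r a ≤ r l) ∧ r a ≤ backPack F (d m) (cnt d (d m) B) ∧
        (backPack F (d m) (cnt d (d m) B) < r a + 1 →
          ∃ x ≤ backPack F (d m) (cnt d (d m) B), (x - 1, r a) ∈ F) := by
      intro m hm hc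
      rcases ha : (B.filter fun l => d l ≤ d m).argmin r with _ | a
      · have := List.argmin_eq_none.1 ha
        rw [cnt, List.countP_eq_length_filter, this] at hc
        simp at hc
      have haA := List.argmin_mem ha
      have hamin : ∀ l ∈ B.filter fun l => d l ≤ d m, r a ≤ r l :=
        fun l hl => List.le_of_mem_argmin hl ha
      have := hF m hm (B.filter fun l => d l ≤ d m) (hnd.filter _)
        (fun l hl => hBj (List.mem_of_mem_filter hl)) a haA
        (fun l hl => ⟨by simpa using (List.mem_filter.1 hl).2, hamin l hl⟩)
      rw [← List.countP_eq_length_filter] at this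
      simp only [List.mem_filter, decide_eq_true_eq] at haA hamin
      exact ⟨a, haA.1, haA.2, fun l hl hld => hamin l ⟨hl, hld⟩, this⟩
    -- A packing begins at a point outside of `F`, not before `s` or the least release time, so
    -- `leaveUp` does not pass it.
    have hs'le : ∀ m ∈ jobs, 0 < cnt d (d m) B →
        s' ≤ backPack F (d m) (cnt d (d m) B) := by
      intro m hm hc
      obtain ⟨a, haB, -, -, ha, -⟩ := hann m hm hc
      exact hs3 _ (max_le (hΦ m hm hc) ((hkr a haB).trans ha)) (backPack_outside F _ hc)
    have hcnt : ∀ δ, cnt d δ B = cnt d δ (B.erase j) + if d j ≤ δ then 1 else 0 := by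
      intro δ
      have := (List.perm_cons_erase hjB).countP_eq fun l => decide (d l ≤ δ)
      rw [cnt, this, List.countP_cons, cnt]
      simp
    obtain ⟨h1, h2, h3⟩ := ih (s' + 1) (B.erase j) (Function.update t j s')
      (by rw [List.length_erase_of_mem hjB, hB]; rfl) (hnd.erase j)
      (fun l hl => hBj (List.mem_of_mem_erase hl)) (by
        intro m hm hc
        have hcB := hcnt (d m)
        have hle := hs'le m hm (by omega)
        split_ifs at hcB with hjm
        · rw [hcB] at hle
          linarith [backPack_succ_le F (d m) (cnt d (d m) (B.erase j))]
        -- The chosen job is due after `d m`, so the earliest released job `a` due by `d m` is not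
        -- yet released at `s'`. If the packing began before `s' + 1`, a region `(x - 1, r a)` with
        -- `x < s' + 1` would be in `F` and contain `s'`, contrary to `hs2`.
        · rw [Nat.add_zero] at hcB
          obtain ⟨a, haB, ham, -, ha1, ha2⟩ := hann m hm (by omega)
          rw [← hcB]
          by_contra hlt
          rw [not_le] at hlt
          have hra : s' < r a := by
            by_contra hra
            exact hjm ((hjd a haB (not_lt.1 hra)).trans ham)
          obtain ⟨x, hx, hxF⟩ := ha2 (by linarith)
          exact hs2 _ hxF ⟨by dsimp only; linarith, hra⟩)
    set t' := generate F r d n (s' + 1) (B.erase j) (Function.update t j s') with ht'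
    have hjt : t' j = s' := by
      rw [h1 j (by simp [hnd.mem_erase_iff])]
      simp
    have hor : ∀ l ∈ B, l = j ∨ l ∈ B.erase j := by
      intro l hl
      by_cases h : l = j
      · exact Or.inl h
      · exact Or.inr ((List.mem_erase_of_ne h).2 hl)
    have hss' : s ≤ s' := (le_max_left _ _).trans hs1
    refine ⟨?_, ?_, ?_, ?_, ?_, ?_⟩
    · intro l hl
      have hlj : l ≠ j := by
        rintro rfl
        exact hl hjB
      rw [h1 l fun h => hl (List.mem_of_mem_erase h), Function.update_of_ne hlj]
    · intro l hl
      rcases hor l hl with rfl | h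
      · rwa [hjt]
      · linarith [h2 l h]
    · intro l hl
      rcases hor l hl with rfl | h
      · rwa [hjt]
      · exact h3.release l h
    · intro l hl
      rcases hor l hl with rfl | h
      · rw [hjt]
        have hc : 0 < cnt d (d l) B := cnt_pos.2 ⟨l, hl, le_rfl⟩
        exact (hs'le l (hBj hl) hc).trans (backPack_le F _ hc)
      · exact h3.deadline l h
    · intro l hl
      rcases hor l hl with rfl | h
      · rwa [hjt]
      · exact h3.outside l h
    · intro l hl m hm hlm
      rcases hor l hl with rfl | hl' <;> rcases hor m hm with rfl | hm'
      · exact absurd rfl hlm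
      · rw [hjt, abs_sub_comm, abs_of_nonneg (by linarith [h2 m hm'])]
        linarith [h2 m hm']
      · rw [hjt, abs_of_nonneg (by linarith [h2 l hl'])]
        linarith [h2 l hl']
      · exact h3.separated l hl' m hm' hlm

/-- The sequence returned by Polynomial is the order of a feasible schedule, if there is any. -/
theorem polynomial_order {jobs : List ι} {r d : ι → ℝ} {F₀ : List (ℝ × ℝ)} {τ : ι → ℝ}
    (hτ : Feasible jobs r d F₀ τ) (hnd : jobs.Nodup) (hr : ∀ j ∈ jobs, 0 ≤ r j) :
    ∃ t, Feasible jobs r d F₀ t ∧ (polynomial jobs r d F₀).2.1.Perm jobs ∧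
      (polynomial jobs r d F₀).2.1.Pairwise fun i j => t i ≤ t j := by
  set σ := jobs.insertionSort fun i j => r i ≤ r j with hσ
  have hperm : σ.Perm jobs := List.perm_insertionSort _ _
  have : Std.Total fun i j : ι => r i ≤ r j := ⟨fun i j => le_total _ _⟩
  have : IsTrans ι fun i j : ι => r i ≤ r j := ⟨fun i j k => le_trans⟩
  have hsort : σ.Pairwise fun i j => r i ≤ r j := List.pairwise_insertionSort _ _
  have hann := announced_declLoop hτ hperm hnd hsort
  have hinv := declInv_declLoop hτ σ none hperm.subset (hperm.nodup_iff.2 hnd) hsort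
  set st := declLoop jobs r d F₀ none σ with hst
  obtain ⟨-, -, ht⟩ := generate_spec hann jobs.length 0 jobs (fun _ => 0) rfl hnd
    (fun _ h => h) (by
      -- Time `0` satisfies the invariant because release times, hence the starts in `τ`, are
      -- nonnegative.
      intro k hk hc
      obtain ⟨a, ha, hle⟩ := hinv.feasible.exists_le_backPack (fun _ h => h) hnd hc
      exact ((hr a ha).trans (hτ.release a ha)).trans hle)
  set t := generate st.F r d jobs.length 0 jobs fun _ => 0 with htdef
  -- The sequence is the same for both answers, so the answer of Polynomial need not be determined.
  have hπ : (polynomial jobs r d F₀).2.1 = jobs.insertionSort fun i j => t i ≤ t j := by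
    unfold polynomial
    dsimp only
    split_ifs <;> rfl
  have : Std.Total fun i j : ι => t i ≤ t j := ⟨fun i j => le_total _ _⟩
  have : IsTrans ι fun i j : ι => t i ≤ t j := ⟨fun i j k => le_trans⟩
  refine ⟨t, ⟨ht.release, ht.deadline, fun j hj => (ht.outside j hj).mono hinv.subset,
    ht.separated⟩, ?_, ?_⟩
  · rw [hπ]
    exact List.perm_insertionSort _ _
  · rw [hπ]
    exact List.pairwise_insertionSort _ _

end Generation

/-! ## State estimates -/

namespace Vehicle

variable {V : Vehicle}

/-- The assumptions under which the state estimates for inputs in `U` and initial states in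
`[a, b]` are trajectories. -/
structure Regular (V : Vehicle) (U : Set (ℝ → ℝ)) (a b : ℝ × ℝ) : Prop where
  wellPosed : V.WellPosed
  orderPreserving : V.OrderPreserving
  positionMonotone : V.PositionMonotone
  subset : U ⊆ V.inputs
  extremes : HasExtremes U
  dists_extremes : HasExtremes V.dists
  le : a ≤ b
  box_subset : Set.Icc a b ⊆ V.X

lemma WellPosed.isTrajectory_traj (hV : V.WellPosed) {u : ℝ → ℝ} (hu : u ∈ V.inputs)
    {d : ℝ → ℝ × ℝ} (hd : d ∈ V.dists) {x0 : ℝ × ℝ} (hx : x0 ∈ V.X) :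
    V.IsTrajectory u d x0 (V.traj u d x0) := by
  have h := hV.exists_traj u hu d hd x0 hx
  rw [traj, dif_pos h]
  exact h.choose_spec

lemma WellPosed.traj_zero (hV : V.WellPosed) {u : ℝ → ℝ} (hu : u ∈ V.inputs)
    {d : ℝ → ℝ × ℝ} (hd : d ∈ V.dists) {x0 : ℝ × ℝ} (hx : x0 ∈ V.X) : V.traj u d x0 0 = x0 := by
  simpa using (hV.isTrajectory_traj hu hd hx 0 le_rfl).2.2

lemma WellPosed.continuousOn_traj (hV : V.WellPosed) {u : ℝ → ℝ} (hu : u ∈ V.inputs)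
    {d : ℝ → ℝ × ℝ} (hd : d ∈ V.dists) {x0 : ℝ × ℝ} (hx : x0 ∈ V.X) (t : ℝ) :
    ContinuousOn (V.traj u d x0) (Set.Icc 0 t) := by
  rcases lt_or_ge t 0 with ht | ht
  · simp [Set.Icc_eq_empty (not_le.2 ht)]
  have hT := hV.isTrajectory_traj hu hd hx
  have h := intervalIntegral.continuousOn_primitive_interval' (hT t ht).2.1 Set.left_mem_uIcc
  rw [Set.uIcc_of_le ht] at h
  exact (continuousOn_const.add h).congr fun s hs => (hT s hs.1).2.2

namespace Regular

variable {U : Set (ℝ → ℝ)} {a b : ℝ × ℝ}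

lemma left_mem (h : V.Regular U a b) : a ∈ V.X := h.box_subset (Set.left_mem_Icc.2 h.le)

lemma right_mem (h : V.Regular U a b) : b ∈ V.X := h.box_subset (Set.right_mem_Icc.2 h.le)

lemma traj_le_traj (h : V.Regular U a b) {u u' : ℝ → ℝ} (hu : u ∈ U) (hu' : u' ∈ U)
    {d d' : ℝ → ℝ × ℝ} (hd : d ∈ V.dists) (hd' : d' ∈ V.dists) {x x' : ℝ × ℝ}
    (hx : x ∈ V.X) (hx' : x' ∈ V.X) (hle : SigLE u u') (hdle : SigLE d d') (hxle : x ≤ x') {t : ℝ}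
    (ht : 0 ≤ t) : V.traj u d x t ≤ V.traj u' d' x' t :=
  ((h.orderPreserving.input u (h.subset hu) u' (h.subset hu') d hd x hx hle t ht).trans
    (h.orderPreserving.dist u' (h.subset hu') d hd d' hd' x hx hdle t ht)).trans
    (h.orderPreserving.init u' (h.subset hu') d' hd' x hx x' hx' hxle t ht)

lemma isLeast (h : V.Regular U a b) {u : ℝ → ℝ} (hu : u ∈ U) (hmin : ∀ g ∈ U, SigLE u g)
    {d : ℝ → ℝ × ℝ} (hd : d ∈ V.dists) (hdmin : ∀ g ∈ V.dists, SigLE d g) {t : ℝ} (ht : 0 ≤ t) :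
    IsLeast (Prod.fst '' V.reach U a b t) (V.traj u d a t).1 := by
  refine ⟨⟨_, ⟨u, hu, d, hd, a, Set.left_mem_Icc.2 h.le, rfl⟩, rfl⟩, ?_⟩
  rintro _ ⟨_, ⟨u', hu', d', hd', x, hx, rfl⟩, rfl⟩
  exact (h.traj_le_traj hu hu' hd hd' h.left_mem (h.box_subset hx) (hmin u' hu')
    (hdmin d' hd') hx.1 ht).1

lemma isGreatest (h : V.Regular U a b) {u : ℝ → ℝ} (hu : u ∈ U) (hmax : ∀ g ∈ U, SigLE g u)
    {d : ℝ → ℝ × ℝ} (hd : d ∈ V.dists) (hdmax : ∀ g ∈ V.dists, SigLE g d) {t : ℝ} (ht : 0 ≤ t) :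
    IsGreatest (Prod.fst '' V.reach U a b t) (V.traj u d b t).1 := by
  refine ⟨⟨_, ⟨u, hu, d, hd, b, Set.right_mem_Icc.2 h.le, rfl⟩, rfl⟩, ?_⟩
  rintro _ ⟨_, ⟨u', hu', d', hd', x, hx, rfl⟩, rfl⟩
  exact (h.traj_le_traj hu' hu hd' hd (h.box_subset hx) h.right_mem (hmax u' hu')
    (hdmax d' hd') hx.2 ht).1

lemma lowerState_fst (h : V.Regular U a b) {u : ℝ → ℝ} (hu : u ∈ U) (hmin : ∀ g ∈ U, SigLE u g)
    {d : ℝ → ℝ × ℝ} (hd : d ∈ V.dists) (hdmin : ∀ g ∈ V.dists, SigLE d g) {t : ℝ} (ht : 0 ≤ t) :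
    (V.lowerState U a b t).1 = (V.traj u d a t).1 :=
  -- The infimum in `ℝ × ℝ` is componentwise by definition.
  (h.isLeast hu hmin hd hdmin ht).csInf_eq

lemma upperState_fst (h : V.Regular U a b) {u : ℝ → ℝ} (hu : u ∈ U) (hmax : ∀ g ∈ U, SigLE g u)
    {d : ℝ → ℝ × ℝ} (hd : d ∈ V.dists) (hdmax : ∀ g ∈ V.dists, SigLE g d) {t : ℝ} (ht : 0 ≤ t) :
    (V.upperState U a b t).1 = (V.traj u d b t).1 :=
  (h.isGreatest hu hmax hd hdmax ht).csSup_eq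

/-- A single trajectory realises the estimate at all times, so the estimate inherits monotonicity
and continuity in time. -/
lemma exists_lowerState (h : V.Regular U a b) : ∃ u ∈ V.inputs, ∃ d ∈ V.dists, ∀ t, 0 ≤ t →
    (V.lowerState U a b t).1 = (V.traj u d a t).1 := by
  obtain ⟨u, hu, hmin⟩ := h.extremes.1
  obtain ⟨d, hd, hdmin⟩ := h.dists_extremes.1
  exact ⟨u, h.subset hu, d, hd, fun t ht => h.lowerState_fst hu hmin hd hdmin ht⟩

lemma exists_upperState (h : V.Regular U a b) : ∃ u ∈ V.inputs, ∃ d ∈ V.dists, ∀ t, 0 ≤ t →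
    (V.upperState U a b t).1 = (V.traj u d b t).1 := by
  obtain ⟨u, hu, hmax⟩ := h.extremes.2
  obtain ⟨d, hd, hdmax⟩ := h.dists_extremes.2
  exact ⟨u, h.subset hu, d, hd, fun t ht => h.upperState_fst hu hmax hd hdmax ht⟩

lemma lowerState_mem (h : V.Regular U a b) {t : ℝ} (ht : 0 ≤ t) :
    (V.lowerState U a b t).1 ∈ Prod.fst '' V.reach U a b t := by
  obtain ⟨u, hu, hmin⟩ := h.extremes.1
  obtain ⟨d, hd, hdmin⟩ := h.dists_extremes.1
  rw [h.lowerState_fst hu hmin hd hdmin ht]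
  exact (h.isLeast hu hmin hd hdmin ht).1

lemma upperState_mem (h : V.Regular U a b) {t : ℝ} (ht : 0 ≤ t) :
    (V.upperState U a b t).1 ∈ Prod.fst '' V.reach U a b t := by
  obtain ⟨u, hu, hmax⟩ := h.extremes.2
  obtain ⟨d, hd, hdmax⟩ := h.dists_extremes.2
  rw [h.upperState_fst hu hmax hd hdmax ht]
  exact (h.isGreatest hu hmax hd hdmax ht).1

lemma lowerState_le_upperState (h : V.Regular U a b) {t : ℝ} (ht : 0 ≤ t) :
    (V.lowerState U a b t).1 ≤ (V.upperState U a b t).1 := by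
  obtain ⟨u, hu, hmin⟩ := h.extremes.1
  obtain ⟨d, hd, hdmin⟩ := h.dists_extremes.1
  rw [h.lowerState_fst hu hmin hd hdmin ht]
  exact (h.isLeast hu hmin hd hdmin ht).2 (h.upperState_mem ht)

lemma lowerState_zero (h : V.Regular U a b) : (V.lowerState U a b 0).1 = a.1 := by
  obtain ⟨u, hu, d, hd, heq⟩ := h.exists_lowerState
  rw [heq 0 le_rfl, h.wellPosed.traj_zero hu hd h.left_mem]

lemma upperState_zero (h : V.Regular U a b) : (V.upperState U a b 0).1 = b.1 := by
  obtain ⟨u, hu, d, hd, heq⟩ := h.exists_upperState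
  rw [heq 0 le_rfl, h.wellPosed.traj_zero hu hd h.right_mem]

lemma lowerState_mono (h : V.Regular U a b) {s t : ℝ} (hs : 0 ≤ s) (hst : s ≤ t) :
    (V.lowerState U a b s).1 ≤ (V.lowerState U a b t).1 := by
  obtain ⟨u, hu, d, hd, heq⟩ := h.exists_lowerState
  rw [heq s hs, heq t (hs.trans hst)]
  exact h.positionMonotone u hu d hd a h.left_mem hs (hs.trans hst : (0 : ℝ) ≤ t) hst

lemma upperState_mono (h : V.Regular U a b) {s t : ℝ} (hs : 0 ≤ s) (hst : s ≤ t) :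
    (V.upperState U a b s).1 ≤ (V.upperState U a b t).1 := by
  obtain ⟨u, hu, d, hd, heq⟩ := h.exists_upperState
  rw [heq s hs, heq t (hs.trans hst)]
  exact h.positionMonotone u hu d hd b h.right_mem hs (hs.trans hst : (0 : ℝ) ≤ t) hst

lemma exists_lowerState_eq (h : V.Regular U a b) {t c : ℝ} (ht : 0 ≤ t)
    (h0 : a.1 ≤ c) (hc : c ≤ (V.lowerState U a b t).1) :
    ∃ s, 0 ≤ s ∧ s ≤ t ∧ (V.lowerState U a b s).1 = c := by
  obtain ⟨u, hu, d, hd, heq⟩ := h.exists_lowerState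
  have hcont := continuous_fst.comp_continuousOn
    (h.wellPosed.continuousOn_traj hu hd h.left_mem t)
  have hz := h.lowerState_zero
  rw [heq 0 le_rfl] at hz
  rw [heq t ht] at hc
  obtain ⟨s, hs, hsc⟩ := intermediate_value_Icc ht hcont
    (⟨by simpa [hz] using h0, by simpa using hc⟩)
  exact ⟨s, hs.1, hs.2, (heq s hs.1).trans hsc⟩

lemma exists_upperState_eq (h : V.Regular U a b) {t c : ℝ} (ht : 0 ≤ t)
    (h0 : b.1 ≤ c) (hc : c ≤ (V.upperState U a b t).1) :
    ∃ s, 0 ≤ s ∧ s ≤ t ∧ (V.upperState U a b s).1 = c := by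
  obtain ⟨u, hu, d, hd, heq⟩ := h.exists_upperState
  have hcont := continuous_fst.comp_continuousOn
    (h.wellPosed.continuousOn_traj hu hd h.right_mem t)
  have hz := h.upperState_zero
  rw [heq 0 le_rfl] at hz
  rw [heq t ht] at hc
  obtain ⟨s, hs, hsc⟩ := intermediate_value_Icc ht hcont
    (⟨by simpa [hz] using h0, by simpa using hc⟩)
  exact ⟨s, hs.1, hs.2, (heq s hs.1).trans hsc⟩

/-- A position strictly between two bounds is possible if the position estimation meets them. -/
lemma exists_position (h : V.Regular U a b) (hI : V.PositionsInterval U a b) {t : ℝ} (ht : 0 ≤ t)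
    {p q : ℝ} (hpq : p < q) (hp : p < (V.upperState U a b t).1)
    (hq : (V.lowerState U a b t).1 < q) :
    ∃ z ∈ Prod.fst '' V.reach U a b t, z ∈ Set.Ioo p q := by
  have hle := h.lowerState_le_upperState ht
  set l := (V.lowerState U a b t).1 with hl
  set r := (V.upperState U a b t).1 with hr
  have hm : p < min q r := lt_min hpq hp
  have hmq := min_le_left q r
  have hmr := min_le_right q r
  -- The midpoint of `p` and `min q r` lies in `(p, q)` and below `r`; raising it to `l` if
  -- necessary keeps it in `(p, q)`, as `l < q`.
  refine ⟨max l ((p + min q r) / 2), (hI t ht).out (h.lowerState_mem ht) (h.upperState_mem ht)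
    ⟨le_max_left _ _, max_le hle (by linarith)⟩, lt_max_of_lt_right (by linarith),
    max_lt hq (by linarith)⟩

end Regular

end Vehicle

/-! ## Occupied intersections -/

namespace Instance

variable {nc nu : ℕ} {S : Instance nc nu}

lemma Standing.regular_ctrl (hS : S.Standing) {j : Fin nc} {u : ℝ → ℝ}
    (hu : u ∈ (S.ctrl j).inputs) :
    (S.ctrl j).Regular {u} (S.xa (Sum.inl j)) (S.xb (Sum.inl j)) where
  wellPosed := hS.wellPosed _
  orderPreserving := hS.orderPreserving _
  positionMonotone := hS.positionMonotone _
  subset := by simpa using hu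
  extremes := ⟨⟨u, rfl, by rintro _ rfl t _; exact le_rfl⟩,
    ⟨u, rfl, by rintro _ rfl t _; exact le_rfl⟩⟩
  dists_extremes := hS.dists_extremes _
  le := hS.init_le _
  box_subset := hS.init_sub _

lemma Standing.regular_unctrl (hS : S.Standing) (γ : Fin nu) :
    (S.unctrl γ).Regular (S.unctrl γ).inputs (S.xa (Sum.inr γ)) (S.xb (Sum.inr γ)) where
  wellPosed := hS.wellPosed _
  orderPreserving := hS.orderPreserving _
  positionMonotone := hS.positionMonotone _
  subset := fun _ h => h
  extremes := hS.inputs_extremes γ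
  dists_extremes := hS.dists_extremes _
  le := hS.init_le _
  box_subset := hS.init_sub _

variable (S) in
/-- The inputs of vehicle `i` that are possible when the controlled vehicles apply `u`. -/
def inputsOf (u : Fin nc → ℝ → ℝ) (i : Fin nc ⊕ Fin nu) : Set (ℝ → ℝ) :=
  Sum.elim (fun j => {u j}) (fun γ => (S.unctrl γ).inputs) i

variable (S) in
/-- The position estimation of vehicle `i` meets its inflated intersection at time `t`. -/
def Occupied (u : Fin nc → ℝ → ℝ) (i : Fin nc ⊕ Fin nu) (t : ℝ) : Prop :=
  (S.veh i).α < S.betaHat i ∧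
  (S.veh i).α < ((S.veh i).upperState (S.inputsOf u i) (S.xa i) (S.xb i) t).1 ∧
  ((S.veh i).lowerState (S.inputsOf u i) (S.xa i) (S.xb i) t).1 < S.betaHat i

lemma Standing.regular (hS : S.Standing) {u : Fin nc → ℝ → ℝ} (hu : ∀ j, u j ∈ (S.ctrl j).inputs)
    (i : Fin nc ⊕ Fin nu) : (S.veh i).Regular (S.inputsOf u i) (S.xa i) (S.xb i) := by
  rcases i with j | γ
  · exact hS.regular_ctrl (hu j)
  · exact hS.regular_unctrl γ

lemma Standing.positionsInterval (hS : S.Standing) {u : Fin nc → ℝ → ℝ}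
    (hu : ∀ j, u j ∈ (S.ctrl j).inputs) (i : Fin nc ⊕ Fin nu) :
    (S.veh i).PositionsInterval (S.inputsOf u i) (S.xa i) (S.xb i) := by
  rcases i with j | γ
  · exact hS.interval_ctrl j _ (hu j)
  · exact hS.interval_unctrl γ

/-- Under an input that avoids the inflated Bad set, a controlled vehicle and another vehicle
never occupy their intersections at the same time. -/
lemma Avoids.not_occupied (hS : S.Standing) {u : Fin nc → ℝ → ℝ}
    (hu : ∀ j, u j ∈ (S.ctrl j).inputs) (ha : S.Avoids S.badHat u) {i : Fin nc ⊕ Fin nu}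
    {j : Fin nc} (hij : i ≠ Sum.inl j) {t : ℝ} (ht : 0 ≤ t) (hi : S.Occupied u i t)
    (hj : S.Occupied u (Sum.inl j) t) : False := by
  -- A reachable position is chosen for every vehicle, since a configuration prescribes all of them;
  -- only those of `i` and `j` are constrained.
  have hex : ∀ k, ∃ z ∈ Prod.fst '' (S.veh k).reach (S.inputsOf u k) (S.xa k) (S.xb k) t,
      k = i ∨ k = Sum.inl j → z ∈ Set.Ioo (S.veh k).α (S.betaHat k) := by
    intro k
    by_cases hk : S.Occupied u k t
    · obtain ⟨z, hz, hz'⟩ := (hS.regular hu k).exists_position (hS.positionsInterval hu k) ht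
        hk.1 hk.2.1 hk.2.2
      exact ⟨z, hz, fun _ => hz'⟩
    · refine ⟨_, (hS.regular hu k).lowerState_mem ht, ?_⟩
      rintro (rfl | rfl)
      · exact absurd hi hk
      · exact absurd hj hk
  have hex' : ∀ k, ∃ v ∈ S.inputsOf u k, ∃ d ∈ (S.veh k).dists,
      ∃ x0 ∈ Set.Icc (S.xa k) (S.xb k), k = i ∨ k = Sum.inl j →
        ((S.veh k).traj v d x0 t).1 ∈ Set.Ioo (S.veh k).α (S.betaHat k) := by
    intro k
    obtain ⟨_, ⟨_, ⟨v, hv, d, hd, x0, hx0, rfl⟩, rfl⟩, h⟩ := hex k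
    exact ⟨v, hv, d, hd, x0, hx0, h⟩
  choose v hv d hd x0 hx0 hz using hex'
  have helim : ∀ k, Sum.elim u (fun γ => v (Sum.inr γ)) k = v k := by
    rintro (k | γ)
    · exact (Set.mem_singleton_iff.1 (hv (Sum.inl k))).symm
    · rfl
  refine ha (fun γ => v (Sum.inr γ)) (fun γ => hv (Sum.inr γ)) d hd x0 hx0 t ht ⟨?_, i, j, hij, ?_⟩
  · intro k
    simp only [output, helim]
    exact ((hS.wellPosed k).isTrajectory_traj ((hS.regular hu k).subset (hv k)) (hd k)
      (hS.init_sub k (hx0 k)) t ht).1.1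
  · simp only [output, helim]
    exact ⟨hz i (Or.inl rfl), hz _ (Or.inr rfl)⟩

/-! ## Scheduling parameters -/

lemma Standing.lt (hS : S.Standing) (i : Fin nc ⊕ Fin nu) : (S.veh i).α < (S.veh i).β :=
  (hS.wellPosed i).lt

lemma Standing.ya0_le_yb0 (hS : S.Standing) (i : Fin nc ⊕ Fin nu) : S.ya0 i ≤ S.yb0 i :=
  (hS.init_le i).1

lemma Standing.ya_le_yb (hS : S.Standing) {j : Fin nc} {u : ℝ → ℝ} (hu : u ∈ (S.ctrl j).inputs)
    {t : ℝ} (ht : 0 ≤ t) : S.ya j u t ≤ S.yb j u t :=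
  (hS.regular_ctrl hu).lowerState_le_upperState ht

lemma P_le_thetaMax {j : Fin nc} {T : ℝ≥0∞} (hT : T ∈ Set.Icc (S.R j) (S.D j)) :
    S.P j T ≤ S.thetaMax :=
  le_iSup_of_le j (le_iSup₂_of_le T hT le_rfl)

lemma P_zero_le_thetaMax {j : Fin nc} (hj : ¬ S.Before j) : S.P j 0 ≤ S.thetaMax :=
  P_le_thetaMax ⟨by simp [R, hj], zero_le⟩

lemma R_le_D (hP : S.ParametersDefined) {j : Fin nc} (hj : S.Before j) : S.R j ≤ S.D j := by
  have hR := hP.R_ne j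
  rw [R, if_pos hj] at hR ⊢
  rw [D, if_pos hj]
  rcases (S.entryTimes j).eq_empty_or_nonempty with h | ⟨T, hT⟩
  · simp [h] at hR
  · exact (sInf_le hT).trans (le_sSup hT)

lemma mem_Icc_of_entry {j : Fin nc} (hj : S.Before j) {u : ℝ → ℝ} (hu : u ∈ (S.ctrl j).inputs)
    {t : ℝ} (ht : 0 ≤ t) (h : S.yb j u t = (S.ctrl j).α) :
    ENNReal.ofReal t ∈ Set.Icc (S.R j) (S.D j) := by
  have hmem : ENNReal.ofReal t ∈ S.entryTimes j := ⟨u, hu, t, ht, h, rfl⟩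
  rw [R, D, if_pos hj, if_pos hj]
  exact ⟨sInf_le hmem, le_sSup hmem⟩

lemma Standing.ya0_lt_of_before (hS : S.Standing) {j : Fin nc} (hj : S.Before j) :
    S.ya0 (Sum.inl j) < (S.ctrl j).β :=
  ((hS.ya0_le_yb0 _).trans_lt hj).trans (hS.lt (Sum.inl j))

/-- As `thetaMax` is finite, so is `P j T`, and hence the set defining it is nonempty. -/
lemma exists_input_of_mem_Icc (hS : S.Standing) (hP : S.ParametersDefined) {j : Fin nc}
    (hj : S.Before j) {T : ℝ≥0∞} (hT : T ∈ Set.Icc (S.R j) (S.D j)) :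
    ∃ u ∈ (S.ctrl j).inputs, S.yb j u T.toReal = (S.ctrl j).α ∧
      ∃ t, T.toReal ≤ t ∧ S.ya j u t = (S.ctrl j).β := by
  have hne : S.P j T ≠ ∞ := ne_top_of_le_ne_top hP.theta_ne (P_le_thetaMax hT)
  rw [P, if_neg (not_le.2 (hS.ya0_lt_of_before hj)), if_pos hj] at hne
  by_contra hno
  apply hne
  rw [sInf_eq_top]
  rintro p ⟨-, u, hu, h1, t, ht, h2, -⟩
  exact absurd ⟨u, hu, h1, t, ht, h2⟩ hno

/-- Some input enters exactly at the infimum `R j`, and the vehicle starts strictly before its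
intersection. Strictness matters where the left ends of forbidden regions are clipped at `0`. -/
lemma R_pos (hS : S.Standing) (hP : S.ParametersDefined) {j : Fin nc} (hj : S.Before j) :
    0 < S.R j := by
  obtain ⟨u, hu, h, -⟩ := exists_input_of_mem_Icc hS hP hj ⟨le_rfl, R_le_D hP hj⟩
  refine pos_iff_ne_zero.2 fun h0 => ?_
  rw [h0, ENNReal.toReal_zero] at h
  have h1 : S.yb j u 0 = S.yb0 (Sum.inl j) := (hS.regular_ctrl hu).upperState_zero
  rw [h1] at h
  exact absurd hj (by rw [Before, h]; exact lt_irrefl _)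

/-- The maximal speed of a vehicle whose lower position estimate advances is positive. -/
lemma vmax_pos (hS : S.Standing) {j : Fin nc} {u : ℝ → ℝ} (hu : u ∈ (S.ctrl j).inputs) {s t : ℝ}
    (hs : 0 ≤ s) (hst : s ≤ t) (h : S.ya j u s < S.ya j u t) : 0 < (S.ctrl j).vmax := by
  have h1 := hS.speed_le j u hu s t hs hst
  by_contra hv
  have := mul_nonpos_of_nonpos_of_nonneg (not_lt.1 hv) (sub_nonneg.2 hst)
  linarith

lemma before_vmax_pos (hS : S.Standing) (hP : S.ParametersDefined) {j : Fin nc}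
    (hj : S.Before j) : 0 < (S.ctrl j).vmax := by
  obtain ⟨u, hu, h, t, ht, h'⟩ := exists_input_of_mem_Icc hS hP hj ⟨le_rfl, R_le_D hP hj⟩
  refine vmax_pos hS hu ENNReal.toReal_nonneg ht ?_
  rw [h']
  exact (hS.ya_le_yb hu ENNReal.toReal_nonneg).trans_lt (h.trans_lt (hS.lt (Sum.inl j)))

/-- On entry the lower estimate is at most α, so reaching β takes it at least `(β - α) / vmax`,
which therefore bounds `P j (R j)` from below. -/
lemma before_le_theta (hS : S.Standing) (hP : S.ParametersDefined) {j : Fin nc}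
    (hj : S.Before j) :
    (S.ctrl j).β - (S.ctrl j).α ≤ S.thetaMax.toReal * (S.ctrl j).vmax := by
  have hv := before_vmax_pos hS hP hj
  rw [← div_le_iff₀ hv, ← ENNReal.ofReal_le_iff_le_toReal hP.theta_ne]
  refine le_trans ?_ (P_le_thetaMax (j := j) ⟨le_rfl, R_le_D hP hj⟩)
  rw [P, if_neg (not_le.2 (hS.ya0_lt_of_before hj)), if_pos hj]
  refine le_sInf ?_
  rintro p ⟨-, u, hu, h, t, ht, h', rfl⟩
  refine ENNReal.ofReal_le_ofReal ?_
  rw [div_le_iff₀' hv]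
  have h1 := hS.speed_le j u hu _ t ENNReal.toReal_nonneg ht
  have h2 := hS.ya_le_yb hu (ENNReal.toReal_nonneg (a := S.R j))
  linarith

lemma theta_pos (hS : S.Standing) (hP : S.ParametersDefined) {j : Fin nc} (hj : S.Before j) :
    0 < S.thetaMax.toReal := by
  have h1 := before_le_theta hS hP hj
  have h2 := before_vmax_pos hS hP hj
  have h3 : (S.ctrl j).α < (S.ctrl j).β := hS.lt (Sum.inl j)
  by_contra h
  have := mul_nonpos_of_nonpos_of_nonneg (not_lt.1 h) h2.le
  linarith

/-- The inflated intersection of a vehicle that is in its intersection at time `0` contains the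
intersection. -/
lemma beta_le_betaHat (hS : S.Standing) (hP : S.ParametersDefined)
    (hβ : ∀ j : Fin nc, (S.ctrl j).α < S.ya0 (Sum.inl j) → S.ya0 (Sum.inl j) < (S.ctrl j).β →
      (S.ctrl j).β ≤ S.betaHat (Sum.inl j)) {j : Fin nc} (hj : ¬ S.Before j)
    (hya : S.ya0 (Sum.inl j) < (S.ctrl j).β) : (S.ctrl j).β ≤ S.betaHat (Sum.inl j) := by
  by_cases hα : (S.ctrl j).α < S.ya0 (Sum.inl j)
  · exact hβ j hα hya
  -- Here the lower estimate starts at or before α, so at speed at most `vmax` it needs at least `(β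
  -- - α) / vmax` to leave.
  have hle := P_zero_le_thetaMax hj
  rw [P, if_neg (not_le.2 hya), if_neg hj] at hle
  have hne : sInf {p | ∃ u ∈ (S.ctrl j).inputs, ∃ t : ℝ, 0 ≤ t ∧ S.ya j u t = (S.ctrl j).β ∧
      p = ENNReal.ofReal t} ≠ ∞ := ne_top_of_le_ne_top hP.theta_ne hle
  have hzero : ∀ u ∈ (S.ctrl j).inputs, S.ya j u 0 = S.ya0 (Sum.inl j) :=
    fun u hu => (hS.regular_ctrl hu).lowerState_zero
  have hv : 0 < (S.ctrl j).vmax := by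
    by_contra hv
    apply hne
    rw [sInf_eq_top]
    rintro p ⟨u, hu, t, ht, h, -⟩
    exact absurd (vmax_pos hS hu le_rfl ht (by rwa [hzero u hu, h])) hv
  have hθ : ((S.ctrl j).β - S.ya0 (Sum.inl j)) / (S.ctrl j).vmax ≤ S.thetaMax.toReal := by
    rw [← ENNReal.ofReal_le_iff_le_toReal hP.theta_ne]
    refine le_trans (le_sInf ?_) hle
    rintro p ⟨u, hu, t, ht, h, rfl⟩
    refine ENNReal.ofReal_le_ofReal ?_
    rw [div_le_iff₀' hv]
    have h1 := hS.speed_le j u hu 0 t le_rfl ht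
    rw [hzero u hu, h] at h1
    linarith
  rw [div_le_iff₀ hv] at hθ
  simp only [betaHat]
  linarith

/-- Every input brings a vehicle to its intersection by the deadline. -/
lemma exists_entry (hS : S.Standing) (hP : S.ParametersDefined) {j : Fin nc} (hj : S.Before j)
    {u : ℝ → ℝ} (hu : u ∈ (S.ctrl j).inputs) : ∃ t, 0 ≤ t ∧ S.yb j u t = (S.ctrl j).α := by
  obtain ⟨u₁, hu₁, h₁, -⟩ := exists_input_of_mem_Icc hS hP hj ⟨le_rfl, R_le_D hP hj⟩
  set T := (S.D j).toReal + 1 with hT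
  have hT0 : 0 ≤ T := add_nonneg ENNReal.toReal_nonneg zero_le_one
  by_cases hα : (S.ctrl j).α ≤ S.yb j u T
  · obtain ⟨s, hs, -, h⟩ := (hS.regular_ctrl hu).exists_upperState_eq hT0 (le_of_lt hj) hα
    exact ⟨s, hs, h⟩
  -- Just after the deadline `u` would not have entered, whereas `u₁` would. By connectedness of the
  -- input space some input enters exactly at `T > D j`, contrary to the definition of `D j`.
  exfalso
  have hRT : (S.R j).toReal ≤ T := by
    have := ENNReal.toReal_mono (hP.D_ne j) (R_le_D hP hj)
    linarith
  have hα₁ : (S.ctrl j).α ≤ S.yb j u₁ T := by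
    rw [← h₁]
    exact (hS.regular_ctrl hu₁).upperState_mono ENNReal.toReal_nonneg hRT
  obtain ⟨top, hpc, hcont⟩ := hS.continuousInInput j
  obtain ⟨d, hd, hdmax⟩ := (hS.dists_extremes (Sum.inl j)).2
  have hyb : ∀ v ∈ (S.ctrl j).inputs,
      S.yb j v T = ((S.ctrl j).traj v d (S.xb (Sum.inl j)) T).1 := fun v hv =>
    (hS.regular_ctrl hv).upperState_fst rfl (by rintro _ rfl t _; exact le_rfl) hd hdmax hT0
  have hc : Continuous fun v : (S.ctrl j).inputs => S.yb j v T := by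
    have := continuous_fst.comp
      (hcont d hd (S.xb (Sum.inl j)) (hS.regular_ctrl hu).right_mem T hT0)
    refine this.congr fun v => ?_
    exact (hyb v v.2).symm
  obtain ⟨v, hv⟩ := intermediate_value_univ (⟨u, hu⟩ : (S.ctrl j).inputs) ⟨u₁, hu₁⟩ hc
    ⟨(not_le.1 hα).le, hα₁⟩
  have hmem := (mem_Icc_of_entry hj v.2 hT0 hv).2
  rw [ENNReal.ofReal_le_iff_le_toReal (hP.D_ne j)] at hmem
  linarith

/-! ## Uncontrolled vehicles -/

/-- The upper estimate reaches α strictly before the midpoint of `(α, β)`, and the lower estimate,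
staying below it, cannot reach β earlier than that. -/
lemma Rbar_lt_Pbar (hS : S.Standing) (hP : S.ParametersDefined) {γ : Fin nu}
    (hγ : S.yb0 (Sum.inr γ) < (S.unctrl γ).α) : S.Rbar γ < S.Pbar γ := by
  have hreg := hS.regular_unctrl γ
  have hαβ : (S.unctrl γ).α < (S.unctrl γ).β := hS.lt (Sum.inr γ)
  have hya : ¬ (S.unctrl γ).β ≤ S.ya0 (Sum.inr γ) :=
    not_le.2 (((hS.ya0_le_yb0 _).trans_lt hγ).trans hαβ)
  have hPne := hP.Pbar_ne γ
  rw [Pbar, if_neg hya] at hPne ⊢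
  rw [Rbar, if_pos hγ]
  obtain ⟨t, ht, hyt⟩ : ∃ t, 0 ≤ t ∧ S.yaUn γ t = (S.unctrl γ).β := by
    by_contra hno
    apply hPne
    rw [sInf_eq_top]
    rintro p ⟨t, ht, h, -⟩
    exact absurd ⟨t, ht, h⟩ hno
  have hle : (S.unctrl γ).β ≤ S.ybUn γ t := hyt ▸ hreg.lowerState_le_upperState ht
  have h0 : (S.xb (Sum.inr γ)).1 < (S.unctrl γ).α := hγ
  obtain ⟨s, hs, -, hys⟩ := hreg.exists_upperState_eq (c := ((S.unctrl γ).α + (S.unctrl γ).β) / 2)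
    ht (by linarith) (by change _ ≤ S.ybUn γ t; linarith)
  obtain ⟨q, hq, hqs, hyq⟩ := hreg.exists_upperState_eq (c := (S.unctrl γ).α) hs h0.le
    (by linarith)
  have hlt : q < s := lt_of_le_of_ne hqs (by rintro rfl; linarith)
  refine lt_of_le_of_lt (b := ENNReal.ofReal q) (sInf_le ⟨q, hq, hyq, rfl⟩)
    (((ENNReal.ofReal_lt_ofReal_iff_of_nonneg hq).2 hlt).trans_le (le_sInf ?_))
  rintro p ⟨t', ht', h', rfl⟩
  refine ENNReal.ofReal_le_ofReal ?_
  by_contra hts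
  have h1 := hreg.lowerState_mono ht' (not_le.1 hts).le
  have h2 := hreg.lowerState_le_upperState hs
  have h3 : S.yaUn γ t' ≤ S.ybUn γ s := h1.trans h2
  have h4 : S.ybUn γ s = _ := hys
  linarith

lemma Rbar_eq_zero {γ : Fin nu} (hγ : ¬ S.yb0 (Sum.inr γ) < (S.unctrl γ).α) : S.Rbar γ = 0 := by
  rw [Rbar, if_neg hγ]

lemma Rbar_le_Pbar (hS : S.Standing) (hP : S.ParametersDefined) (γ : Fin nu) :
    S.Rbar γ ≤ S.Pbar γ := by
  by_cases hγ : S.yb0 (Sum.inr γ) < (S.unctrl γ).α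
  · exact (Rbar_lt_Pbar hS hP hγ).le
  · simp [Rbar_eq_zero hγ]

/-! ## Occupation times -/

section

variable {u : Fin nc → ℝ → ℝ}

/-- A nondecreasing estimate that takes the value α at most once cannot rest there. -/
lemma lt_upperState (hS : S.Standing) (hP : S.ParametersDefined)
    (hu : ∀ j, u j ∈ (S.ctrl j).inputs) {i : Fin nc ⊕ Fin nu} {s t : ℝ} (hs : 0 ≤ s)
    (hst : s < t)
    (h : (S.veh i).α ≤ ((S.veh i).upperState (S.inputsOf u i) (S.xa i) (S.xb i) s).1) :
    (S.veh i).α < ((S.veh i).upperState (S.inputsOf u i) (S.xa i) (S.xb i) t).1 := by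
  have hmono := (hS.regular hu i).upperState_mono hs hst.le
  refine lt_of_le_of_ne (h.trans hmono) fun heq => hst.ne ?_
  have heqs := le_antisymm (hmono.trans_eq heq.symm) h
  rcases i with j | γ
  · exact hP.entry_unique j _ (hu j) s t hs (hs.trans hst.le) heqs heq.symm
  · exact hP.entry_unique_un γ s t hs (hs.trans hst.le) heqs heq.symm

lemma occupied_of_entry (hS : S.Standing) (hP : S.ParametersDefined)
    (hu : ∀ j, u j ∈ (S.ctrl j).inputs) {j : Fin nc} (hj : S.Before j) {s t : ℝ} (hs : 0 ≤ s)
    (h : S.yb j (u j) s = (S.ctrl j).α) (hst : s < t) (hts : t < s + S.thetaMax.toReal) :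
    S.Occupied u (Sum.inl j) t := by
  have hv := before_vmax_pos hS hP hj
  have h1 := before_le_theta hS hP hj
  have h2 : (S.ctrl j).α < (S.ctrl j).β := hS.lt (Sum.inl j)
  refine ⟨?_, lt_upperState hS hP hu hs hst h.ge, ?_⟩
  · change (S.ctrl j).α < (S.ctrl j).α + S.thetaMax.toReal * (S.ctrl j).vmax
    linarith
  · change S.ya j (u j) t < (S.ctrl j).α + S.thetaMax.toReal * (S.ctrl j).vmax
    have h3 := hS.speed_le j _ (hu j) s t hs hst.le
    have h4 := hS.ya_le_yb (hu j) hs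
    have h5 : (t - s) * (S.ctrl j).vmax < S.thetaMax.toReal * (S.ctrl j).vmax :=
      mul_lt_mul_of_pos_right (by linarith) hv
    linarith

/-- By continuity, a lower estimate at or beyond β at time `t` would have met β by then, forcing `P
j 0 ≤ t`. -/
lemma occupied_of_not_before (hS : S.Standing) (hP : S.ParametersDefined)
    (hβ : ∀ j : Fin nc, (S.ctrl j).α < S.ya0 (Sum.inl j) → S.ya0 (Sum.inl j) < (S.ctrl j).β →
      (S.ctrl j).β ≤ S.betaHat (Sum.inl j))
    (hu : ∀ j, u j ∈ (S.ctrl j).inputs) {j : Fin nc} (hj : ¬ S.Before j) {t : ℝ} (ht : 0 < t)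
    (htP : ENNReal.ofReal t < S.P j 0) : S.Occupied u (Sum.inl j) t := by
  have hreg := hS.regular_ctrl (hu j)
  rw [P] at htP
  split_ifs at htP with hya
  · exact absurd htP not_lt_zero
  have hle := beta_le_betaHat hS hP hβ hj (not_le.1 hya)
  refine ⟨(hS.lt (Sum.inl j)).trans_le hle, lt_upperState hS hP hu le_rfl ht ?_, ?_⟩
  · rw [(hS.regular hu _).upperState_zero]
    exact not_lt.1 hj
  · refine lt_of_lt_of_le ?_ hle
    by_contra hlt
    obtain ⟨s, hs, hst, h⟩ := hreg.exists_lowerState_eq ht.le (not_le.1 hya).le (not_lt.1 hlt)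
    exact not_le.2 htP
      (sInf_le_of_le ⟨u j, hu j, s, hs, h, rfl⟩ (ENNReal.ofReal_le_ofReal hst))

lemma occupied_unctrl (hS : S.Standing) (hP : S.ParametersDefined)
    (hu : ∀ j, u j ∈ (S.ctrl j).inputs) {γ : Fin nu} {t : ℝ}
    (htR : S.Rbar γ < ENNReal.ofReal t) (htP : ENNReal.ofReal t < S.Pbar γ) :
    S.Occupied u (Sum.inr γ) t := by
  have hreg := hS.regular_unctrl γ
  have ht : 0 < t := ENNReal.ofReal_pos.1 (pos_of_gt htR)
  refine ⟨hS.lt (Sum.inr γ), ?_, ?_⟩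
  · rw [Rbar] at htR
    split_ifs at htR with hγ
    · obtain ⟨_, ⟨s, hs, h, rfl⟩, hlt⟩ := sInf_lt_iff.1 htR
      exact lt_upperState hS hP hu hs ((ENNReal.ofReal_lt_ofReal_iff_of_nonneg hs).1 hlt) h.ge
    · refine lt_upperState hS hP hu le_rfl ht ?_
      rw [(hS.regular hu _).upperState_zero]
      exact not_lt.1 hγ
  · rw [Pbar] at htP
    split_ifs at htP with hya
    · exact absurd htP not_lt_zero
    · by_contra hlt
      obtain ⟨s, hs, hst, h⟩ := hreg.exists_lowerState_eq ht.le (not_le.1 hya).le (not_lt.1 hlt)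
      exact not_le.2 htP (sInf_le_of_le ⟨s, hs, h, rfl⟩ (ENNReal.ofReal_le_ofReal hst))

end

/-! ## The unit jobs of an instance -/

variable (S) in
/-- The initial forbidden regions. -/
noncomputable def regions : List (ℝ × ℝ) := (List.finRange nu).map fun γ =>
  (max ((S.Rbar γ).toReal / S.thetaMax.toReal - 1) 0, (S.Pbar γ).toReal / S.thetaMax.toReal)

variable (S) in
/-- The release times of the unit jobs. -/
noncomputable def release (j : Fin nc) : ℝ := (max (S.R j) S.Pmax).toReal / S.thetaMax.toReal

variable (S) in
/-- The deadlines of the unit jobs. -/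
noncomputable def deadline (j : Fin nc) : ℝ := (S.D j).toReal / S.thetaMax.toReal

lemma mem_listM {j : Fin nc} : j ∈ S.listM ↔ S.Before j := by
  simp [listM]

lemma nodup_listM : S.listM.Nodup := (List.nodup_finRange nc).filter _

/-- The schedule consists of the entry times under `u` in units of `thetaMax`. A violated
separation, release bound from `Pmax` or forbidden region would give a time at which two
intersections are occupied. -/
lemma feasible_of_avoids (hS : S.Standing) (hP : S.ParametersDefined)
    (hβ : ∀ j : Fin nc, (S.ctrl j).α < S.ya0 (Sum.inl j) → S.ya0 (Sum.inl j) < (S.ctrl j).β →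
      (S.ctrl j).β ≤ S.betaHat (Sum.inl j)) {u : Fin nc → ℝ → ℝ}
    (hu : ∀ j, u j ∈ (S.ctrl j).inputs) (ha : S.Avoids S.badHat u) :
    ∃ τ, Feasible S.listM S.release S.deadline S.regions τ := by
  have hex : ∀ j, S.Before j → ∃ t, 0 ≤ t ∧ S.yb j (u j) t = (S.ctrl j).α :=
    fun j hj => exists_entry hS hP hj (hu j)
  choose! e he0 he using hex
  have hocc : ∀ j, S.Before j → ∀ t, e j < t → t < e j + S.thetaMax.toReal →
      S.Occupied u (Sum.inl j) t := fun j hj t => occupied_of_entry hS hP hu hj (he0 j hj) (he j hj)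
  have hθ : ∀ j, S.Before j → 0 < S.thetaMax.toReal := fun j hj => theta_pos hS hP hj
  have hsep : ∀ i j, S.Before i → S.Before j → i ≠ j → e i ≤ e j →
      e i + S.thetaMax.toReal ≤ e j := by
    intro i j hi hj hij hle
    by_contra hlt
    obtain ⟨t, ht1, ht2⟩ := exists_between (not_le.1 hlt)
    exact ha.not_occupied hS hu (i := Sum.inl i) (j := j) (by simpa using hij)
      ((he0 j hj).trans ht1.le) (hocc i hi t (by linarith) ht2)
      (hocc j hj t ht1 (by linarith [hθ j hj]))
  refine ⟨fun j => e j / S.thetaMax.toReal, ?_, ?_, ?_, ?_⟩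
  · intro j hjM
    have hj := mem_listM.1 hjM
    refine div_le_div_of_nonneg_right (ENNReal.toReal_le_of_le_ofReal (he0 j hj) (max_le ?_ ?_))
      (hθ j hj).le
    · exact (mem_Icc_of_entry hj (hu j) (he0 j hj) (he j hj)).1
    · refine iSup₂_le fun i hi => ?_
      have hne : S.P i 0 ≠ ∞ := ne_top_of_le_ne_top hP.theta_ne (P_zero_le_thetaMax hi)
      by_contra hlt
      rw [not_le, ENNReal.ofReal_lt_iff_lt_toReal (he0 j hj) hne] at hlt
      obtain ⟨t, ht1, ht2⟩ := exists_between
        (lt_min hlt (lt_add_of_pos_right (e j) (hθ j hj)))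
      obtain ⟨ht2, ht3⟩ := lt_min_iff.1 ht2
      have ht : 0 ≤ t := (he0 j hj).trans ht1.le
      refine ha.not_occupied hS hu (i := Sum.inl i) (j := j) ?_ ht
        (occupied_of_not_before hS hP hβ hu hi ((he0 j hj).trans_lt ht1) ?_) (hocc j hj t ht1 ht3)
      · intro h
        rw [Sum.inl.inj h] at hi
        exact hi hj
      · rwa [ENNReal.ofReal_lt_iff_lt_toReal ht hne]
  · intro j hjM
    have hj := mem_listM.1 hjM
    refine div_le_div_of_nonneg_right ?_ (hθ j hj).le
    rw [← ENNReal.ofReal_le_iff_le_toReal (hP.D_ne j)]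
    exact (mem_Icc_of_entry hj (hu j) (he0 j hj) (he j hj)).2
  · intro j hjM I hI hx
    have hj := mem_listM.1 hjM
    have hθj := hθ j hj
    obtain ⟨γ, -, rfl⟩ := List.mem_map.1 hI
    obtain ⟨h1, h2⟩ := hx
    dsimp only at h1 h2
    have h3 := (le_max_left _ _).trans_lt h1
    rw [div_lt_div_iff_of_pos_right hθj] at h2
    rw [sub_lt_iff_lt_add, div_lt_iff₀ hθj, add_mul, div_mul_cancel₀ _ hθj.ne', one_mul] at h3
    have hPpos : 0 < (S.Pbar γ).toReal := (he0 j hj).trans_lt h2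
    -- With this, the open intervals `(e j, e j + θ)` and `(Rbar γ, Pbar γ)` overlap.
    have hRP : (S.Rbar γ).toReal < (S.Pbar γ).toReal := by
      by_cases hγ : S.yb0 (Sum.inr γ) < (S.unctrl γ).α
      · exact (ENNReal.toReal_lt_toReal (hP.Rbar_ne γ) (hP.Pbar_ne γ)).2 (Rbar_lt_Pbar hS hP hγ)
      · rwa [Rbar_eq_zero hγ, ENNReal.toReal_zero]
    obtain ⟨t, ht1, ht2⟩ := exists_between
      (max_lt (lt_min (lt_add_of_pos_right (e j) hθj) h2) (lt_min h3 hRP))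
    obtain ⟨ht1, ht3⟩ := max_lt_iff.1 ht1
    obtain ⟨ht2, ht4⟩ := lt_min_iff.1 ht2
    have ht : 0 ≤ t := (he0 j hj).trans ht1.le
    refine ha.not_occupied hS hu (i := Sum.inr γ) (j := j) (by simp) ht
      (occupied_unctrl hS hP hu ?_ ?_) (hocc j hj t ht1 ht2)
    · rwa [ENNReal.lt_ofReal_iff_toReal_lt (hP.Rbar_ne γ)]
    · rwa [ENNReal.ofReal_lt_iff_lt_toReal ht (hP.Pbar_ne γ)]
  · intro i hiM j hjM hij
    have hi := mem_listM.1 hiM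
    have hj := mem_listM.1 hjM
    have hθj := hθ j hj
    rw [← sub_div, abs_div, abs_of_pos hθj, le_div_iff₀ hθj, one_mul]
    rcases le_total (e i) (e j) with h | h
    · have := hsep i j hi hj hij h
      rw [abs_sub_comm]
      exact (by linarith : S.thetaMax.toReal ≤ e j - e i).trans (le_abs_self _)
    · have := hsep j i hj hi hij.symm h
      exact (by linarith : S.thetaMax.toReal ≤ e i - e j).trans (le_abs_self _)

/-! ## Procedure Scheduling -/

/-- Moving a start time past the idle-times does not go beyond a start time `τ` at which the
vehicle conflicts with no uncontrolled vehicle for the maximal process time. -/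
lemma avoidIdle_mem {j : Fin nc} {τ : ℝ≥0∞} (hτD : τ ≤ S.D j) (hτ : τ ≠ ∞)
    (hθ : 0 < S.thetaMax) (hRP : ∀ γ, S.Rbar γ ≤ S.Pbar γ)
    (hτγ : ∀ γ, S.Pbar γ ≤ τ ∨ τ + S.thetaMax ≤ S.Rbar γ) {T : ℝ≥0∞}
    (hT : T ∈ Set.Icc (S.R j) τ) : S.avoidIdle j T ∈ Set.Icc (S.R j) τ := by
  unfold avoidIdle
  -- The bound holds for idle-times in any order, as each move keeps `T` between `R j` and `τ`.
  induction S.idleOrder generalizing T with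
  | nil => exact hT
  | cons γ l ih =>
    rw [List.foldl_cons]
    apply ih
    have hlt : τ < τ + S.thetaMax := ENNReal.lt_add_right hτ hθ.ne'
    split_ifs with h1 h2
    · refine ⟨hT.1.trans (le_max_left _ _), max_le hT.2 ((hτγ γ).resolve_right fun h => ?_)⟩
      exact absurd (hlt.trans_le (h.trans (h1.trans hT.2))) (lt_irrefl _)
    · refine ⟨hT.1.trans ((not_le.1 h1).le.trans (hRP γ)), (hτγ γ).resolve_right fun h => ?_⟩
      refine absurd (h2.trans_le ?_) (not_lt.2 h)
      exact add_le_add hT.2 (P_le_thetaMax ⟨hT.1, hT.2.trans hτD⟩)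
    · exact hT

/-- Each start is at most `τ i`, so the vehicle leaves by `τ i + thetaMax`, which is at most `τ j`
for every later `j`; the induction thus continues. -/
lemma scheduleLoop_le {τ : Fin nc → ℝ≥0∞} (hτ : ∀ j, τ j ≠ ∞)
    (hθ : 0 < S.thetaMax) (hRP : ∀ γ, S.Rbar γ ≤ S.Pbar γ) :
    ∀ (l : List (Fin nc)) (e : ℝ≥0∞) (T : Fin nc → ℝ≥0∞), (∀ j ∈ l, S.R j ≤ τ j) →
      (∀ j ∈ l, τ j ≤ S.D j) →
      (∀ j ∈ l, ∀ γ, S.Pbar γ ≤ τ j ∨ τ j + S.thetaMax ≤ S.Rbar γ) →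
      l.Pairwise (fun i j => τ i + S.thetaMax ≤ τ j) → (∀ j ∈ l, e ≤ τ j) →
      (∀ j, j ∉ l → T j ≤ S.D j) → ∀ j, S.scheduleLoop e l T j ≤ S.D j := by
  intro l
  induction l with
  | nil => exact fun e T _ _ _ _ _ hT j => hT j (by simp)
  | cons i l ih =>
    intro e T hR hD hγ hp he hT
    rw [scheduleLoop]
    obtain ⟨hp1, hp2⟩ := List.pairwise_cons.1 hp
    have hmem := avoidIdle_mem (hD i (by simp)) (hτ i) hθ hRP (hγ i (by simp))
      (T := max (S.R i) e) ⟨le_max_left _ _, max_le (hR i (by simp)) (he i (by simp))⟩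
    have hle := hmem.2.trans (hD i (by simp))
    refine ih _ _ (fun j hj => hR j (by simp [hj])) (fun j hj => hD j (by simp [hj]))
      (fun j hj => hγ j (by simp [hj])) hp2 (fun j hj => ?_) fun j hj => ?_
    · exact (add_le_add hmem.2 (P_le_thetaMax ⟨hmem.1, hle⟩)).trans (hp1 j hj)
    · by_cases hji : j = i
      · subst hji
        simpa using hle
      · rw [Function.update_of_ne hji]
        exact hT j (by simp [hji, hj])

/-- Scheduling answers *yes* for the order of a feasible schedule of the unit jobs. -/
lemma scheduling_yes (hS : S.Standing) (hP : S.ParametersDefined) {t : Fin nc → ℝ}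
    (ht : Feasible S.listM S.release S.deadline S.regions t) {π : List (Fin nc)}
    (hπ : π.Perm S.listM) (hsort : π.Pairwise fun i j => t i ≤ t j) :
    (S.scheduling π).2 = true := by
  have hfil : ∀ j ∈ π, S.Before j := fun j hj => mem_listM.1 (hπ.subset hj)
  suffices h : ∀ j, S.scheduleLoop S.Pmax π (fun _ => 0) j ≤ S.D j by
    unfold scheduling
    dsimp only
    rw [List.filter_eq_self.2 (by simpa using hfil), if_pos h]
  by_cases hM : ∃ j, S.Before j
  swap
  · have : π = [] := List.eq_nil_iff_forall_not_mem.2 fun j hj => hM ⟨j, hfil j hj⟩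
    subst this
    intro j
    simp [scheduleLoop]
  obtain ⟨j₀, hj₀⟩ := hM
  have hθ := theta_pos hS hP hj₀
  have hθ' : ENNReal.ofReal S.thetaMax.toReal = S.thetaMax := ENNReal.ofReal_toReal hP.theta_ne
  have hPmax : S.Pmax ≠ ∞ :=
    ne_top_of_le_ne_top hP.theta_ne (iSup₂_le fun i hi => P_zero_le_thetaMax hi)
  have hmax : ∀ j, max (S.R j) S.Pmax ≠ ∞ := fun j => max_ne_top (hP.R_ne j) hPmax
  have hrel : ∀ j ∈ π, max (S.R j) S.Pmax ≤ ENNReal.ofReal (t j * S.thetaMax.toReal) := by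
    intro j hj
    rw [ENNReal.le_ofReal_iff_toReal_le (hmax j)]
    · exact (div_le_iff₀ hθ).1 (ht.release j (hπ.subset hj))
    · have h1 := ht.release j (hπ.subset hj)
      exact mul_nonneg ((div_nonneg ENNReal.toReal_nonneg hθ.le).trans h1) hθ.le
  have hpos : ∀ j ∈ π, 0 < t j := by
    intro j hj
    have h1 := ((R_pos hS hP (hfil j hj)).trans_le (le_max_left _ _)).trans_le (hrel j hj)
    exact pos_of_mul_pos_left (ENNReal.ofReal_pos.1 h1) hθ.le
  refine scheduleLoop_le (τ := fun j => ENNReal.ofReal (t j * S.thetaMax.toReal))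
    (fun j => ENNReal.ofReal_ne_top) ((ENNReal.toReal_pos_iff.1 hθ).1) (Rbar_le_Pbar hS hP) π _ _
    (fun j hj => (le_max_left _ _).trans (hrel j hj)) ?_ ?_ ?_
    (fun j hj => (le_max_right _ _).trans (hrel j hj)) (fun j _ => zero_le)
  · intro j hj
    rw [ENNReal.ofReal_le_iff_le_toReal (hP.D_ne j)]
    exact (le_div_iff₀ hθ).1 (ht.deadline j (hπ.subset hj))
  · intro j hj γ
    have hout := ht.outside j (hπ.subset hj) _ (List.mem_map.2 ⟨γ, List.mem_finRange γ, rfl⟩)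
    dsimp only at hout
    rw [not_and_or, not_lt, not_lt] at hout
    rcases hout with h | h
    · right
      -- A positive start cannot be at or below the clipped left end `0`.
      have h1 : t j ≤ (S.Rbar γ).toReal / S.thetaMax.toReal - 1 :=
        (le_max_iff.1 h).resolve_right (not_le.2 (hpos j hj))
      rw [le_sub_iff_add_le, le_div_iff₀ hθ, add_mul, one_mul] at h1
      have h2 := (ENNReal.ofReal_le_iff_le_toReal (hP.Rbar_ne γ)).2 h1
      rwa [ENNReal.ofReal_add (mul_nonneg (hpos j hj).le hθ.le) hθ.le, hθ'] at h2
    · left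
      rw [ENNReal.le_ofReal_iff_toReal_le (hP.Pbar_ne γ) (mul_nonneg (hpos j hj).le hθ.le)]
      exact (div_le_iff₀ hθ).1 h
  · have hnd : π.Nodup := hπ.nodup_iff.2 nodup_listM
    refine (hsort.and hnd).imp_of_mem fun {i j} hi hj hij => ?_
    have h1 := ht.separated i (hπ.subset hi) j (hπ.subset hj) hij.2
    rw [abs_sub_comm, abs_of_nonneg (sub_nonneg.2 hij.1)] at h1
    have h2 : (t i + 1) * S.thetaMax.toReal ≤ t j * S.thetaMax.toReal :=
      mul_le_mul_of_nonneg_right (by linarith) hθ.le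
    have h3 := ENNReal.ofReal_le_ofReal h2
    rwa [add_mul, one_mul, ENNReal.ofReal_add (mul_nonneg (hpos i hi).le hθ.le) hθ.le, hθ'] at h3

open Classical in
lemma relaxedExact_order (h1 : ¬ (S.positionBox ∩ S.bad).Nonempty)
    (h2 : ¬ ∀ j, ¬ S.Before j) :
    S.relaxedExact.2.1 = (polynomial S.listM S.release S.deadline S.regions).2.1 := by
  unfold relaxedExact
  rw [if_neg h1, if_neg h2]
  change (match polynomial S.listM S.release S.deadline S.regions with
    | (some t, π, true) => (some fun j => if S.Before j then t j * S.thetaMax.toReal else 0, π,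
        true)
    | (_, π, _) => (none, π, false) : Option (Fin nc → ℝ) × List (Fin nc) × Bool).2.1 = _
  rcases polynomial S.listM S.release S.deadline S.regions with ⟨_ | t, π, _ | _⟩ <;> rfl

/-- If the initial position estimation meets the Bad set, then the inflated Bad set cannot be
avoided. -/
lemma not_avoids_of_initial (hS : S.Standing) (hP : S.ParametersDefined)
    (hβ : ∀ j : Fin nc, (S.ctrl j).α < S.ya0 (Sum.inl j) → S.ya0 (Sum.inl j) < (S.ctrl j).β →
      (S.ctrl j).β ≤ S.betaHat (Sum.inl j)) (h : (S.positionBox ∩ S.bad).Nonempty)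
    {u : Fin nc → ℝ → ℝ} (hu : ∀ j, u j ∈ (S.ctrl j).inputs) : ¬ S.Avoids S.badHat u := by
  obtain ⟨y, hbox, -, i, j, hij, hyi, hyj⟩ := h
  have hocc : ∀ k, y k ∈ Set.Ioo (S.veh k).α (S.veh k).β → S.Occupied u k 0 := by
    intro k hk
    have h1 : S.ya0 k < (S.veh k).β := (hbox.1 k).trans_lt hk.2
    have h2 : (S.veh k).α < S.yb0 k := hk.1.trans_le (hbox.2 k)
    have hle : (S.veh k).β ≤ S.betaHat k := by
      rcases k with k | γ
      · exact beta_le_betaHat hS hP hβ (not_lt.2 h2.le) h1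
      · exact le_rfl
    refine ⟨(hS.lt k).trans_le hle, ?_, ?_⟩
    · rwa [(hS.regular hu k).upperState_zero]
    · rw [(hS.regular hu k).lowerState_zero]
      exact h1.trans_le hle
  exact fun ha => ha.not_occupied hS hu hij le_rfl (hocc i hyi) (hocc _ hyj)

end Instance

end Intersection

/-! ### The main theorem -/

theorem mainTheorem4 {nc nu : ℕ} (S : Intersection.Instance nc nu)
    (hS : S.Standing) (hP : S.ParametersDefined)
    (hβ : ∀ j : Fin nc, (S.ctrl j).α < S.ya0 (Sum.inl j) → S.ya0 (Sum.inl j) < (S.ctrl j).β →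
      (S.ctrl j).β ≤ S.betaHat (Sum.inl j))
    (hno : S.approx = (none, false)) :
    ¬ ∃ u : Fin nc → ℝ → ℝ, (∀ j, u j ∈ (S.ctrl j).inputs) ∧ S.Avoids S.badHat u := by
  rintro ⟨u, hu, ha⟩
  have h1 : ¬ (S.positionBox ∩ S.bad).Nonempty :=
    fun h => Intersection.Instance.not_avoids_of_initial hS hP hβ h hu ha
  unfold Intersection.Instance.approx at hno
  rw [if_neg h1] at hno
  split_ifs at hno with hM
  · simp at hno
  · obtain ⟨τ, hτ⟩ := Intersection.Instance.feasible_of_avoids hS hP hβ hu ha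
    obtain ⟨t, ht, hπ, hsort⟩ := Intersection.polynomial_order hτ Intersection.Instance.nodup_listM fun j _ =>
      div_nonneg ENNReal.toReal_nonneg ENNReal.toReal_nonneg
    have hyes := Intersection.Instance.scheduling_yes hS hP ht hπ hsort
    rw [Intersection.Instance.relaxedExact_order h1 (fun h => hM fun j => not_lt.1 (h j))] at hno
    rw [hno] at hyes
    exact absurd hyes (by simp)
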